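/- Let $1\le p,q<\infty$ be real numbers such that $p/q$ is not a natural number, and let $L_p(L_q)=L_p([0,1];L_q[0,1])$ be the Banach lattice (real scalars, Lebesgue measure on $[0,1]$, almost-everywhere order) of classes of strongly measurable functions $f:[0,1]\to L_q[0,1]$ with norm $$\|f\|=\Big(\int_0^1\Big(\int_0^1|f(x,y)|^q\,dy\Big)^{p/q}dx\Big)^{1/p}<\infty .$$ Then $L_p(L_q)$ is approximately ultrahomogeneous over the class of its finitely generated sublattices. That is, let $E$ be a Banach lattice that is lattice isometric to a closed sublattice of $L_p(L_q)$, and let $e_1,\dots,e_n\in E$ generate $E$ as a Banach lattice (no proper closed linear sublattice of $E$ contains all of them). Then for all isometric lattice embeddings (linear isometries preserving $\vee$ and $\wedge$) $f_1,f_2:E\to L_p(L_q)$ and every $\varepsilon>0$ there is a lattice automorphism $\phi$ of $L_p(L_q)$ (a surjective linear isometry preserving $\vee$ and $\wedge$) such that $$\|\phi(f_1(e_j))-f_2(e_j)\|<\varepsilon\qquad\text{for all }1\le j\le n .$$ -/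

import Mathlib

open MeasureTheory

open scoped ENNReal

universe u

/-- A real Banach lattice: a complete normed space with a lattice order that is compatible with
addition and whose norm satisfies `|x| ≤ |y| → ‖x‖ ≤ ‖y‖`. (Compatibility of the order with
multiplication by nonnegative reals follows from these axioms.) -/
structure BanachLattice : Type (u + 1) where
  /-- The underlying type. -/
  carrier : Type u
  [toNormedAddCommGroup : NormedAddCommGroup carrier]
  [toNormedSpace : NormedSpace ℝ carrier]
  [toLattice : Lattice carrier]
  [toHasSolidNorm : HasSolidNorm carrier]
  [toIsOrderedAddMonoid : IsOrderedAddMonoid carrier]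
  [toCompleteSpace : CompleteSpace carrier]

namespace BanachLattice

instance : CoeSort BanachLattice.{u} (Type u) := ⟨BanachLattice.carrier⟩

attribute [instance] toNormedAddCommGroup toNormedSpace toLattice toHasSolidNorm
  toIsOrderedAddMonoid toCompleteSpace

end BanachLattice

/-- A linear isometry between normed lattices is an isometric lattice embedding if it preserves
binary suprema and infima. -/
structure IsLatticeEmbedding {E F : Type*} [NormedAddCommGroup E] [NormedSpace ℝ E] [Lattice E]
    [NormedAddCommGroup F] [NormedSpace ℝ F] [Lattice F] (f : E →ₗᵢ[ℝ] F) : Prop where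
  map_sup : ∀ x y : E, f (x ⊔ y) = f x ⊔ f y
  map_inf : ∀ x y : E, f (x ⊓ y) = f x ⊓ f y

/-- A linear isometric bijection of a normed lattice onto itself is a lattice automorphism if it
preserves binary suprema and infima. -/
def IsLatticeAutomorphism {X : Type*} [NormedAddCommGroup X] [NormedSpace ℝ X] [Lattice X]
    (φ : X ≃ₗᵢ[ℝ] X) : Prop :=
  IsLatticeEmbedding φ.toLinearIsometry

/-- A linear subspace which is closed in norm and closed under the lattice operations. -/
structure IsClosedSublattice {E : Type*} [NormedAddCommGroup E] [NormedSpace ℝ E] [Lattice E]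
    (S : Submodule ℝ E) : Prop where
  sup_mem : ∀ x ∈ S, ∀ y ∈ S, x ⊔ y ∈ S
  inf_mem : ∀ x ∈ S, ∀ y ∈ S, x ⊓ y ∈ S
  isClosed : IsClosed (S : Set E)

/-- The elements `e 0, …, e (n - 1)` generate `E` as a Banach lattice: no proper closed sublattice
contains all of them. -/
def GeneratesLattice {E : Type*} [NormedAddCommGroup E] [NormedSpace ℝ E] [Lattice E]
    {n : ℕ} (e : Fin n → E) : Prop :=
  ∀ S : Submodule ℝ E, IsClosedSublattice S → (∀ j, e j ∈ S) → S = ⊤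

/-- `X` is approximately ultrahomogeneous over the class `𝒢` of Banach lattices: for every `E` in
`𝒢`, all generators `e 0, …, e (n - 1)` of `E`, all isometric lattice embeddings `f₁, f₂` of `E`
into `X` and all `ε > 0` there is an isometric lattice automorphism `φ` of `X` with
`‖φ (f₁ (e j)) - f₂ (e j)‖ < ε` for all `j`. -/
def IsApproxUltrahomogeneousOver (X : Type*) [NormedAddCommGroup X] [NormedSpace ℝ X] [Lattice X]
    (𝒢 : Set BanachLattice.{u}) : Prop :=
  ∀ E ∈ 𝒢, ∀ (n : ℕ) (e : Fin n → E), GeneratesLattice e →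
    ∀ f₁ f₂ : E →ₗᵢ[ℝ] X, IsLatticeEmbedding f₁ → IsLatticeEmbedding f₂ →
      ∀ ε : ℝ, 0 < ε → ∃ φ : X ≃ₗᵢ[ℝ] X, IsLatticeAutomorphism φ ∧
        ∀ j, ‖φ (f₁ (e j)) - f₂ (e j)‖ < ε

/-- The class of finitely generated sublattices of `X`: the finitely generated Banach lattices that
are lattice isometric to a sublattice of `X` (closed in `X`, being complete). -/
def finitelyGeneratedSublattices (X : Type*) [NormedAddCommGroup X] [NormedSpace ℝ X]
    [Lattice X] : Set BanachLattice.{u} :=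
  {E | (∃ (n : ℕ) (e : Fin n → E), GeneratesLattice e) ∧
    ∃ f : E →ₗᵢ[ℝ] X, IsLatticeEmbedding f}

/-- The space `L_p([0,1]; L_q[0,1])` of (classes of) strongly measurable `L_q[0,1]`-valued
functions, for Lebesgue measure on `[0,1]`. Its order is Mathlib's order on `Lp`: `f ≤ g` iff
`f x ≤ g x` in `L_q[0,1]` for almost every `x`, that is, iff `f x y ≤ g x y` for almost every `y`,
for almost every `x`. -/
abbrev LpLq (p q : ℝ≥0∞) [Fact (1 ≤ q)] : Type :=
  Lp (Lp ℝ q (volume : Measure unitInterval)) p (volume : Measure unitInterval)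

/-! An isometric lattice embedding preserves the norm of every lattice term, so the images `h`, `h'`
of the generators satisfy `‖τ(h)‖ = ‖τ(h')‖` for all terms `τ`. This alone makes the two tuples
nearly conjugate under lattice automorphisms: `LatticeTerm.exists_automorphism_of_norm_eval_eq`.

Put `e = ∑ |h j|` and cut the cube containing the ratios `h j / e` into small cells. In the fibre
over `x`, let `w_b(x)` be the `q`-th power of the `L_q`-norm of the part of `e` in cell `b`.
Atomless measures on the interval are isomorphic, so weighted composition operators act almost
transitively on disjoint families in `L_q`; hence the numbers `w_b(x)` determine the fibre tuple up
to an automorphism of `L_q` and a small error (`LatticeTerm.exists_automorphism_of_cellMass`).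

The parts of `e` in the cells are disjoint limits of lattice terms. The norms of terms therefore
determine `∫ (∑ s_b w_b(x))^(p/q) dx` for all `s ≥ 0`. Take `s = 1 + r t` and expand in `r`: since
`p/q` is not a natural number, no binomial coefficient vanishes. This gives all moments of the
bounded vector `w / ∑ w` for the density `(∑ w)^(p/q) = ‖e(x)‖^p`, and so its law
(`setLIntegral_eq_of_integral_rpow_eq`). Non-integrality of `p/q` matters only here.

Discretising `w / ∑ w` gives each fibre one of finitely many colours. By separability of `L_q`,
countably many automorphisms suffice to bring each fibre tuple close to its norm times a fixed
reference tuple of its colour, and the choice can be made measurably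
(`LatticeTerm.exists_reference`, `LatticeTerm.exists_alignment`). What remains is the scalar
function `‖e(x)‖` with its colours. Its `L_p`-norm on each colour is the same for `h` and `h'`, so a
transport of the base nearly exchanges the two (`exists_isTransport_approx`). Conjugating that
transport by the two alignments gives the automorphism. -/

/-! ### Isomorphism of atomless measures on the unit interval -/

-- For fixed `x`, the indicator of `Iic t` at `x` is continuous in `t` except at `t = x`, which is a
-- null event; dominated convergence does the rest.
open Filter Topology in
theorem continuous_measureReal_Iic (P : Measure unitInterval) [IsProbabilityMeasure P]
    [NullSingletonClass P] : Continuous fun t : unitInterval => P.real (Set.Iic t) := by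
  have h : (fun t : unitInterval => P.real (Set.Iic t)) =
      fun t => ∫ x, (Set.Iic t).indicator (fun _ => (1 : ℝ)) x ∂P := by
    funext t
    rw [integral_indicator measurableSet_Iic]
    simp
  rw [h, continuous_iff_continuousAt]
  intro t
  refine continuousAt_of_dominated (bound := fun _ => 1) ?_ ?_ (integrable_const _) ?_
  · exact Eventually.of_forall fun s =>
      (measurable_const.indicator measurableSet_Iic).aestronglyMeasurable
  · refine Eventually.of_forall fun s => Eventually.of_forall fun x => ?_
    by_cases hx : x ≤ s <;> simp [Set.indicator, hx]
  · have : ∀ᵐ x ∂P, x ≠ t := by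
      rw [ae_iff]; simp
    filter_upwards [this] with x hx
    rcases lt_or_gt_of_ne hx with hlt | hgt
    · refine ContinuousAt.congr (f := fun _ => (1 : ℝ)) continuousAt_const ?_
      filter_upwards [lt_mem_nhds hlt] with s hs
      simp [Set.indicator, hs.le]
    · refine ContinuousAt.congr (f := fun _ => (0 : ℝ)) continuousAt_const ?_
      filter_upwards [gt_mem_nhds hgt] with s hs
      simp [Set.indicator, not_le.2 hs]

/-- If `g` is measure preserving and has a measurable almost everywhere left inverse `F`,
then `F` is measure preserving and an almost everywhere right inverse as well. -/
theorem MeasureTheory.MeasurePreserving.of_ae_leftInverse {α β : Type*} [MeasurableSpace α]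
    [MeasurableSpace β] [MeasurableEq β] {μ : Measure α} {ν : Measure β} {g : α → β} {F : β → α}
    (hg : MeasurePreserving g μ ν) (hF : Measurable F) (h : ∀ᵐ x ∂μ, F (g x) = x) :
    MeasurePreserving F ν μ ∧ ∀ᵐ y ∂ν, g (F y) = y := by
  refine ⟨⟨hF, ?_⟩, ?_⟩
  · rw [← hg.map_eq, Measure.map_map hF hg.measurable]
    have : F ∘ g =ᵐ[μ] id := h
    rw [Measure.map_congr this, Measure.map_id]
  · have hm : MeasurableSet {y | g (F y) = y} :=
      measurableSet_eq_fun (hg.measurable.comp hF) measurable_id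
    rw [← hg.map_eq, ae_map_iff hg.measurable.aemeasurable hm]
    filter_upwards [h] with x hx
    rw [hx]

/-- An atomless Borel probability measure on the unit interval is isomorphic to the Lebesgue
measure modulo null sets. -/
theorem exists_ae_iso_volume (P : Measure unitInterval) [IsProbabilityMeasure P] [NullSingletonClass P] :
    ∃ F g : unitInterval → unitInterval, MeasurePreserving F P volume ∧
      MeasurePreserving g volume P ∧ (∀ᵐ s ∂(volume : Measure unitInterval), F (g s) = s) ∧
      ∀ᵐ x ∂P, g (F x) = x := by
  let F : unitInterval → unitInterval := fun t => ⟨P.real (Set.Iic t), measureReal_nonneg,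
    measureReal_le_one⟩
  have hFc : Continuous F := (continuous_measureReal_Iic P).subtype_mk _
  have hFm : Monotone F := fun s t hst => by
    change P.real (Set.Iic s) ≤ P.real (Set.Iic t)
    exact measureReal_mono (Set.Iic_subset_Iic.2 hst)
  have hF0 : F 0 = 0 := by
    apply Subtype.ext
    change P.real (Set.Iic 0) = 0
    have : Set.Iic (0 : unitInterval) = {0} := by
      ext x; exact ⟨fun h => le_antisymm h unitInterval.nonneg', fun h => le_of_eq h⟩
    rw [this]; simp [measureReal_def]
  have hF1 : F 1 = 1 := by
    apply Subtype.ext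
    change P.real (Set.Iic 1) = 1
    have : Set.Iic (1 : unitInterval) = Set.univ := by
      ext x; simp [unitInterval.le_one']
    rw [this]; simp
  let g : unitInterval → unitInterval := fun s => sInf {t | s ≤ F t}
  have hmem : ∀ s, s ≤ F (g s) := by
    intro s
    have hc : IsClosed {t | s ≤ F t} := isClosed_le continuous_const hFc
    exact IsClosed.sInf_mem ⟨1, by simpa [hF1] using unitInterval.le_one'⟩ hc
  -- The distribution function `F` and the quantile function `g` form a Galois connection. It gives
  -- measurability of `g` and computes the image of Lebesgue measure under `g` on the sets `Iic t`.
  have hiff : ∀ s t, g s ≤ t ↔ s ≤ F t := fun s t =>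
    ⟨fun h => (hmem s).trans (hFm h), fun h => sInf_le h⟩
  -- Absence of atoms enters here: `F` is continuous, hence onto by the intermediate value theorem.
  have hFg : ∀ s, F (g s) = s := by
    intro s
    refine le_antisymm ?_ (hmem s)
    have hs : s ∈ Set.Icc (F 0) (F 1) := by
      rw [hF0, hF1]; exact ⟨unitInterval.nonneg', unitInterval.le_one'⟩
    obtain ⟨t, -, ht⟩ := intermediate_value_Icc (show (0 : unitInterval) ≤ 1 from zero_le_one)
      hFc.continuousOn hs
    rw [← ht]
    exact hFm ((hiff _ _).2 le_rfl)
  have hgm : Measurable g := by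
    refine measurable_of_Iic fun t => ?_
    have : g ⁻¹' Set.Iic t = Set.Iic (F t) := by ext s; exact hiff s t
    rw [this]; exact measurableSet_Iic
  have hg : MeasurePreserving g volume P := by
    refine ⟨hgm, ?_⟩
    have : IsProbabilityMeasure (Measure.map g (volume : Measure unitInterval)) :=
      Measure.isProbabilityMeasure_map hgm.aemeasurable
    refine Measure.ext_of_Iic _ _ fun t => ?_
    rw [Measure.map_apply hgm measurableSet_Iic]
    have : g ⁻¹' Set.Iic t = Set.Iic (F t) := by ext s; exact hiff s t
    rw [this, unitInterval.volume_Iic]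
    change ENNReal.ofReal (P.real (Set.Iic t)) = _
    rw [measureReal_def, ENNReal.ofReal_toReal (measure_ne_top _ _)]
  have hae : ∀ᵐ s ∂(volume : Measure unitInterval), F (g s) = s :=
    Filter.Eventually.of_forall hFg
  obtain ⟨h1, h2⟩ := hg.of_ae_leftInverse hFc.measurable hae
  exact ⟨F, g, h1, hg, hae, h2⟩

/-- Any two atomless Borel probability measures on the unit interval are isomorphic modulo null
sets. -/
theorem exists_ae_iso (P Q : Measure unitInterval) [IsProbabilityMeasure P] [NullSingletonClass P]
    [IsProbabilityMeasure Q] [NullSingletonClass Q] :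
    ∃ S T : unitInterval → unitInterval, MeasurePreserving S P Q ∧ MeasurePreserving T Q P ∧
      (∀ᵐ x ∂P, T (S x) = x) ∧ ∀ᵐ x ∂Q, S (T x) = x := by
  obtain ⟨F, g, hF, hg, hFg, hgF⟩ := exists_ae_iso_volume P
  obtain ⟨F', g', hF', hg', hFg', hgF'⟩ := exists_ae_iso_volume Q
  refine ⟨g' ∘ F, g ∘ F', hg'.comp hF, hg.comp hF', ?_, ?_⟩
  · filter_upwards [hgF, hF.quasiMeasurePreserving.ae hFg'] with x h1 h2
    simp [h2, h1]
  · filter_upwards [hgF', hF'.quasiMeasurePreserving.ae hFg] with x h1 h2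
    simp [h2, h1]

/-- Colourwise isomorphisms modulo null sets can be glued. -/
theorem exists_ae_iso_of_color {ι : Type*} [Fintype ι] [MeasurableSpace ι]
    [MeasurableSingletonClass ι]
    (P Q : Measure unitInterval) [NullSingletonClass P] [NullSingletonClass Q] (c d : unitInterval → ι)
    (hc : Measurable c) (hd : Measurable d)
    (hP : ∀ a, P (c ⁻¹' {a}) = 1) (hQ : ∀ a, Q (d ⁻¹' {a}) = 1) :
    ∃ S T : unitInterval → unitInterval, MeasurePreserving S P Q ∧ MeasurePreserving T Q P ∧
      (∀ᵐ x ∂P, T (S x) = x) ∧ (∀ᵐ x ∂P, d (S x) = c x) := by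
  have hP' : ∀ a, IsProbabilityMeasure (P.restrict (c ⁻¹' {a})) := fun a => ⟨by simp [hP]⟩
  have hQ' : ∀ a, IsProbabilityMeasure (Q.restrict (d ⁻¹' {a})) := fun a => ⟨by simp [hQ]⟩
  choose S T hS hT hTS hST using fun a => exists_ae_iso (P.restrict (c ⁻¹' {a}))
    (Q.restrict (d ⁻¹' {a}))
  have hsum : ∀ (R : Measure unitInterval) (c : unitInterval → ι), Measurable c →
      R = Measure.sum fun a => R.restrict (c ⁻¹' {a}) := by
    intro R c hc
    rw [← Measure.restrict_iUnion (fun a b hab => ?_) fun a => hc (measurableSet_singleton a)]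
    · rw [← Set.preimage_iUnion, Set.iUnion_of_singleton, Set.preimage_univ,
        Measure.restrict_univ]
    · exact Disjoint.preimage _ (by simpa using hab)
  have hglue : ∀ (S : ι → unitInterval → unitInterval) (c : unitInterval → ι), Measurable c →
      (∀ a, Measurable (S a)) → Measurable fun x => S (c x) x := fun S c hc hS =>
    (measurable_from_prod_countable_right hS (f := fun z : ι × unitInterval => S z.1 z.2)).comp
      (hc.prodMk measurable_id)
  have hcol : ∀ (R : Measure unitInterval) (c : unitInterval → ι) (a : ι), Measurable c →
      ∀ᵐ x ∂(R.restrict (c ⁻¹' {a})), c x = a := fun R c a hc => by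
    filter_upwards [ae_restrict_mem (hc (measurableSet_singleton a))] with x hx using hx
  have key : ∀ (P Q : Measure unitInterval) (c d : unitInterval → ι)
      (S : ι → unitInterval → unitInterval), Measurable c → Measurable d →
      (∀ a, MeasurePreserving (S a) (P.restrict (c ⁻¹' {a})) (Q.restrict (d ⁻¹' {a}))) →
      MeasurePreserving (fun x => S (c x) x) P Q := by
    intro P Q c d S hc hd hS
    have hm := hglue S c hc fun a => (hS a).measurable
    refine ⟨hm, ?_⟩
    conv_lhs => rw [hsum P c hc]
    conv_rhs => rw [hsum Q d hd]
    rw [Measure.map_sum hm.aemeasurable]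
    congr 1
    funext a
    rw [← (hS a).map_eq]
    refine Measure.map_congr ?_
    filter_upwards [hcol P c a hc] with x hx
    rw [hx]
  have hdS : ∀ᵐ x ∂P, d (S (c x) x) = c x := by
    rw [hsum P c hc, Measure.ae_sum_iff]
    intro a
    filter_upwards [hcol P c a hc, (hS a).quasiMeasurePreserving.ae (hcol Q d a hd)] with x h1 h2
    rw [h1, h2]
  refine ⟨fun x => S (c x) x, fun x => T (d x) x, key P Q c d S hc hd hS, key Q P d c T hd hc hT,
    ?_, hdS⟩
  rw [hsum P c hc, Measure.ae_sum_iff]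
  intro a
  filter_upwards [hcol P c a hc, (hS a).quasiMeasurePreserving.ae (hcol Q d a hd), hTS a]
    with x h1 h2 h3
  rw [h1, h2, h3]

/-! ### Lattice automorphisms of vector-valued `L_p` -/

instance MeasureTheory.Lp.instPosSMulMono {α V : Type*} [MeasurableSpace α] {μ : Measure α}
    {p : ℝ≥0∞} [NormedAddCommGroup V] [NormedSpace ℝ V] [PartialOrder V] [PosSMulMono ℝ V] :
    PosSMulMono ℝ (Lp V p μ) := by
  refine ⟨fun c hc f g hfg => ?_⟩
  have hfg' : f ≤ g := hfg
  rw [← Lp.coeFn_le] at hfg'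
  change c • f ≤ c • g
  rw [← Lp.coeFn_le]
  filter_upwards [Lp.coeFn_smul c f, Lp.coeFn_smul c g, hfg'] with x h1 h2 h3
  rw [h1, h2]
  exact smul_le_smul_of_nonneg_left h3 hc

theorem smul_sup_of_pos {V : Type*} [AddCommGroup V] [Module ℝ V] [Lattice V] [PosSMulMono ℝ V]
    {c : ℝ} (hc : 0 < c) (a b : V) : c • (a ⊔ b) = c • a ⊔ c • b :=
  (OrderIso.smulRight hc : V ≃o V).map_sup a b

theorem smul_inf_of_pos {V : Type*} [AddCommGroup V] [Module ℝ V] [Lattice V] [PosSMulMono ℝ V]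
    {c : ℝ} (hc : 0 < c) (a b : V) : c • (a ⊓ b) = c • a ⊓ c • b :=
  (OrderIso.smulRight hc : V ≃o V).map_inf a b

section Automorphisms

variable {α V : Type*} [MeasurableSpace α] {μ : Measure α} {p : ℝ≥0∞} [Fact (1 ≤ p)]
  [NormedAddCommGroup V] [NormedSpace ℝ V] [Lattice V] [HasSolidNorm V] [IsOrderedAddMonoid V]

/-- An operation on functions that is linear, preserves the lattice operations and the norm, and
is surjective modulo null sets, induces a lattice automorphism of `L_p`. -/
theorem exists_automorphism_of_pointwise (Φ : (α → V) → α → V)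
    (hae : ∀ f g, f =ᵐ[μ] g → Φ f =ᵐ[μ] Φ g)
    (hmeas : ∀ f, MemLp f p μ → AEStronglyMeasurable (Φ f) μ)
    (hnorm : ∀ f, MemLp f p μ → eLpNorm (Φ f) p μ = eLpNorm f p μ)
    (hadd : ∀ f g, Φ (f + g) = Φ f + Φ g) (hsmul : ∀ (c : ℝ) f, Φ (c • f) = c • Φ f)
    (hsup : ∀ f g, Φ (f ⊔ g) = Φ f ⊔ Φ g) (hinf : ∀ f g, Φ (f ⊓ g) = Φ f ⊓ Φ g)
    (hsurj : ∀ g, MemLp g p μ → ∃ f, MemLp f p μ ∧ Φ f =ᵐ[μ] g) :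
    ∃ R : Lp V p μ ≃ₗᵢ[ℝ] Lp V p μ, IsLatticeAutomorphism R ∧ ∀ f, R f =ᵐ[μ] Φ f := by
  have hmem : ∀ f, MemLp f p μ → MemLp (Φ f) p μ := fun f hf =>
    ⟨hmeas f hf, by rw [hnorm f hf]; exact hf.2⟩
  let L : Lp V p μ → Lp V p μ := fun f => (hmem f (Lp.memLp f)).toLp
  have hL : ∀ f, L f =ᵐ[μ] Φ f := fun f => MemLp.coeFn_toLp _
  let R₀ : Lp V p μ →ₗᵢ[ℝ] Lp V p μ :=
    { toFun := L
      map_add' := fun f g => by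
        ext1
        filter_upwards [hL (f + g), hae _ _ (Lp.coeFn_add f g), Lp.coeFn_add (L f) (L g), hL f,
          hL g] with x h1 h2 h3 h4 h5
        rw [h1, h2, h3, hadd, Pi.add_apply, Pi.add_apply, h4, h5]
      map_smul' := fun c f => by
        ext1
        filter_upwards [hL (c • f), hae _ _ (Lp.coeFn_smul c f), Lp.coeFn_smul c (L f), hL f]
          with x h1 h2 h3 h4
        rw [RingHom.id_apply, h1, h2, h3, hsmul, Pi.smul_apply, Pi.smul_apply, h4]
      norm_map' := fun f => by
        change ‖L f‖ = ‖f‖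
        rw [Lp.norm_toLp, hnorm _ (Lp.memLp f), Lp.norm_def] }
  have hR₀ : ∀ f, R₀ f = L f := fun _ => rfl
  have hs : Function.Surjective R₀ := fun g => by
    obtain ⟨f, hf, hfg⟩ := hsurj g (Lp.memLp g)
    refine ⟨hf.toLp, ?_⟩
    ext1
    filter_upwards [hL hf.toLp, hae _ _ hf.coeFn_toLp, hfg] with x h1 h2 h3
    rw [hR₀, h1, h2, h3]
  refine ⟨LinearIsometryEquiv.ofSurjective R₀ hs, ⟨fun f g => ?_, fun f g => ?_⟩, hL⟩
  · change L (f ⊔ g) = L f ⊔ L g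
    ext1
    filter_upwards [hL (f ⊔ g), hae _ _ (Lp.coeFn_sup f g), Lp.coeFn_sup (L f) (L g), hL f, hL g]
      with x h1 h2 h3 h4 h5
    rw [h1, h2, h3, hsup, Pi.sup_apply, Pi.sup_apply, h4, h5]
  · change L (f ⊓ g) = L f ⊓ L g
    ext1
    filter_upwards [hL (f ⊓ g), hae _ _ (Lp.coeFn_inf f g), Lp.coeFn_inf (L f) (L g), hL f, hL g]
      with x h1 h2 h3 h4 h5
    rw [h1, h2, h3, hinf, Pi.inf_apply, Pi.inf_apply, h4, h5]

/-- Weighted composition operators are lattice automorphisms of vector-valued `L_p`. -/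
theorem exists_automorphism_weightedComp [PosSMulMono ℝ V] (hp : p ≠ ∞) (σ τ : α → α) (w : α → ℝ)
    (hw : Measurable w)
    (hw0 : ∀ x, 0 < w x) (hσ : Measure.QuasiMeasurePreserving σ μ μ)
    (hτ : Measure.QuasiMeasurePreserving τ μ μ) (hτσ : ∀ᵐ x ∂μ, τ (σ x) = x)
    (hwσ : MeasurePreserving σ (μ.withDensity fun x => ENNReal.ofReal (w x) ^ p.toReal) μ) :
    ∃ R : Lp V p μ ≃ₗᵢ[ℝ] Lp V p μ, IsLatticeAutomorphism R ∧
      ∀ f, R f =ᵐ[μ] fun x => w x • f (σ x) := by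
  have hp0 : p ≠ 0 := (lt_of_lt_of_le zero_lt_one (Fact.out : 1 ≤ p)).ne'
  have hnorm : ∀ f : α → V, AEStronglyMeasurable f μ →
      eLpNorm (fun x => w x • f (σ x)) p μ = eLpNorm f p μ := by
    intro f hf
    rw [eLpNorm_eq_lintegral_rpow_enorm_toReal hp0 hp,
      eLpNorm_eq_lintegral_rpow_enorm_toReal hp0 hp]
    congr 1
    have hm : AEMeasurable (fun x => ‖f x‖ₑ ^ p.toReal) μ := hf.enorm.pow_const _
    have hd : Measurable fun x => ENNReal.ofReal (w x) ^ p.toReal :=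
      hw.ennreal_ofReal.pow_const _
    rw [← hwσ.map_eq] at hm
    conv_rhs => rw [← hwσ.map_eq]
    rw [lintegral_map' hm hwσ.aemeasurable]
    refine Eq.trans (lintegral_congr fun x => ?_) (lintegral_withDensity_eq_lintegral_mul₀'
      hd.aemeasurable (hm.comp_aemeasurable hwσ.aemeasurable)).symm
    rw [enorm_smul, ENNReal.mul_rpow_of_nonneg _ _ ENNReal.toReal_nonneg, Pi.mul_apply,
      Real.enorm_eq_ofReal (hw0 x).le]
    rfl
  refine exists_automorphism_of_pointwise (fun f x => w x • f (σ x)) ?_ ?_ ?_ ?_ ?_ ?_ ?_ ?_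
  · intro f g hfg
    filter_upwards [hσ.ae hfg] with x hx
    rw [hx]
  · intro f hf
    exact hw.aestronglyMeasurable.smul (hf.1.comp_quasiMeasurePreserving hσ)
  · exact fun f hf => hnorm f hf.1
  · intro f g; ext x; simp
  · intro c f; ext x; simp [smul_comm c]
  · intro f g; ext x; simp [smul_sup_of_pos (hw0 x)]
  · intro f g; ext x; simp [smul_inf_of_pos (hw0 x)]
  · intro g hg
    -- Only `τ ∘ σ = id` is needed: the norm identity gives `‖f‖ = ‖g‖` once the operator is known
    -- to send `f` to `g`.
    let f : α → V := fun x => (w (τ x))⁻¹ • g (τ x)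
    have hf : AEStronglyMeasurable f μ :=
      (((hw.inv.aestronglyMeasurable).smul hg.1).comp_quasiMeasurePreserving hτ :)
    have hfg : (fun x => w x • f (σ x)) =ᵐ[μ] g := by
      filter_upwards [hτσ] with x hx
      simp [f, hx, smul_smul, mul_inv_cancel₀ (hw0 x).ne']
    refine ⟨f, ⟨hf, ?_⟩, hfg⟩
    rw [← hnorm f hf, eLpNorm_congr_ae hfg]
    exact hg.2

/-- Applying, at each point, one of countably many automorphisms of `V`, chosen measurably, gives
an automorphism of `L_p(V)`. -/
theorem exists_automorphism_piecewise (c : α → ℕ) (hc : Measurable c) (T : ℕ → V ≃ₗᵢ[ℝ] V)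
    (hT : ∀ k, IsLatticeAutomorphism (T k)) :
    ∃ R : Lp V p μ ≃ₗᵢ[ℝ] Lp V p μ, IsLatticeAutomorphism R ∧
      ∀ f, R f =ᵐ[μ] fun x => T (c x) (f x) := by
  have hmeas : ∀ (S : ℕ → V ≃ₗᵢ[ℝ] V) (f : α → V), AEStronglyMeasurable f μ →
      AEStronglyMeasurable (fun x => S (c x) (f x)) μ := by
    intro S f hf
    have h : (⋃ k, c ⁻¹' {k}) = Set.univ := by
      rw [← Set.preimage_iUnion, Set.iUnion_of_singleton, Set.preimage_univ]
    rw [← Measure.restrict_univ (μ := μ), ← h, aestronglyMeasurable_iUnion_iff]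
    intro k
    have : AEStronglyMeasurable (fun x => S k (f x)) (μ.restrict (c ⁻¹' {k})) :=
      (S k).continuous.comp_aestronglyMeasurable hf.restrict
    refine this.congr ?_
    filter_upwards [ae_restrict_mem (hc (measurableSet_singleton k))] with x hx
    have : c x = k := hx
    rw [this]
  have hnorm : ∀ (S : ℕ → V ≃ₗᵢ[ℝ] V) (f : α → V),
      eLpNorm (fun x => S (c x) (f x)) p μ = eLpNorm f p μ := fun S f =>
    eLpNorm_congr_norm_ae (Filter.Eventually.of_forall fun x => by simp)
  refine exists_automorphism_of_pointwise (fun f x => T (c x) (f x)) ?_ ?_ ?_ ?_ ?_ ?_ ?_ ?_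
  · intro f g hfg
    filter_upwards [hfg] with x hx
    rw [hx]
  · exact fun f hf => hmeas T f hf.1
  · exact fun f _ => hnorm T f
  · intro f g; ext x; simp
  · intro r f; ext x; simp
  · intro f g; ext x; exact (hT (c x)).map_sup _ _
  · intro f g; ext x; exact (hT (c x)).map_inf _ _
  · intro g hg
    refine ⟨fun x => (T (c x)).symm (g x), ⟨hmeas (fun k => (T k).symm) g hg.1, ?_⟩, ?_⟩
    · rw [hnorm fun k => (T k).symm]; exact hg.2
    · exact Filter.Eventually.of_forall fun x => by simp

end Automorphisms

theorem IsLatticeAutomorphism.trans {X : Type*} [NormedAddCommGroup X] [NormedSpace ℝ X]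
    [Lattice X] {φ ψ : X ≃ₗᵢ[ℝ] X} (hφ : IsLatticeAutomorphism φ) (hψ : IsLatticeAutomorphism ψ) :
    IsLatticeAutomorphism (φ.trans ψ) :=
  ⟨fun x y => (congrArg ψ (hφ.map_sup x y)).trans (hψ.map_sup _ _),
    fun x y => (congrArg ψ (hφ.map_inf x y)).trans (hψ.map_inf _ _)⟩

theorem IsLatticeAutomorphism.symm {X : Type*} [NormedAddCommGroup X] [NormedSpace ℝ X]
    [Lattice X] {φ : X ≃ₗᵢ[ℝ] X} (hφ : IsLatticeAutomorphism φ) :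
    IsLatticeAutomorphism φ.symm := by
  refine ⟨fun x y => φ.injective ?_, fun x y => φ.injective ?_⟩
  · have := hφ.map_sup (φ.symm x) (φ.symm y)
    simp only [LinearIsometryEquiv.coe_toLinearIsometry, LinearIsometryEquiv.apply_symm_apply]
      at this ⊢
    rw [this]
  · have := hφ.map_inf (φ.symm x) (φ.symm y)
    simp only [LinearIsometryEquiv.coe_toLinearIsometry, LinearIsometryEquiv.apply_symm_apply]
      at this ⊢
    rw [this]

/-! ### Transports and their approximate transitivity on disjoint families -/

/-- The weighted composition operator `f ↦ w • f ∘ σ` is a lattice automorphism of `L_r(V)`, for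
every coefficient lattice `V`. -/
structure IsTransport (r : ℝ≥0∞) [Fact (1 ≤ r)] (σ : unitInterval → unitInterval)
    (w : unitInterval → ℝ) : Prop where
  quasiMeasurePreserving : Measure.QuasiMeasurePreserving σ volume volume
  exists_automorphism : ∀ (V : Type) [NormedAddCommGroup V] [NormedSpace ℝ V] [Lattice V]
    [HasSolidNorm V] [IsOrderedAddMonoid V] [PosSMulMono ℝ V],
    ∃ R : Lp V r (volume : Measure unitInterval) ≃ₗᵢ[ℝ] Lp V r (volume : Measure unitInterval),
      IsLatticeAutomorphism R ∧ ∀ f, R f =ᵐ[volume] fun x => w x • f (σ x)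

theorem MeasureTheory.MeasurePreserving.withDensity_comp {α β : Type*} [MeasurableSpace α]
    [MeasurableSpace β] {μ : Measure α} {ν : Measure β} {S : α → β} (hS : MeasurePreserving S μ ν)
    {g : β → ℝ≥0∞} (hg : Measurable g) :
    MeasurePreserving S (μ.withDensity (g ∘ S)) (ν.withDensity g) := by
  refine ⟨hS.measurable, ?_⟩
  ext A hA
  rw [Measure.map_apply hS.measurable hA, withDensity_apply _ (hS.measurable hA),
    withDensity_apply _ hA]
  exact hS.setLIntegral_comp_preimage hA hg

/-- Two positive functions with the same colourwise masses are exchanged by a transport. -/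
theorem exists_isTransport_of_lintegral_eq_one {ι : Type*} [Fintype ι] [MeasurableSpace ι]
    [MeasurableSingletonClass ι] (r : ℝ≥0∞) [Fact (1 ≤ r)] (hr : r ≠ ∞)
    {u v : unitInterval → ℝ} {c d : unitInterval → ι} (hu : Measurable u) (hv : Measurable v)
    (hu0 : ∀ x, 0 < u x) (hv0 : ∀ x, 0 < v x) (hc : Measurable c) (hd : Measurable d)
    (hcu : ∀ a, ∫⁻ x in c ⁻¹' {a}, ENNReal.ofReal (u x) ^ r.toReal = 1)
    (hdv : ∀ a, ∫⁻ x in d ⁻¹' {a}, ENNReal.ofReal (v x) ^ r.toReal = 1) :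
    ∃ σ w, IsTransport r σ w ∧ ∀ᵐ x, c (σ x) = d x ∧ w x = v x / u (σ x) := by
  have hr0 : 0 ≤ r.toReal := ENNReal.toReal_nonneg
  have hpow : ∀ t : ℝ, 0 < t → ENNReal.ofReal t ^ r.toReal ≠ 0 ∧
      ENNReal.ofReal t ^ r.toReal ≠ ∞ := fun t ht =>
    ⟨(ENNReal.rpow_pos (ENNReal.ofReal_pos.2 ht) ENNReal.ofReal_ne_top).ne',
      ENNReal.rpow_ne_top_of_nonneg hr0 ENNReal.ofReal_ne_top⟩
  let dens : (unitInterval → ℝ) → unitInterval → ℝ≥0∞ := fun u x =>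
    ENNReal.ofReal (u x) ^ r.toReal
  have hdens : ∀ u, Measurable u → Measurable (dens u) := fun u hu =>
    hu.ennreal_ofReal.pow_const _
  let P : Measure unitInterval := volume.withDensity (dens u)
  let Q : Measure unitInterval := volume.withDensity (dens v)
  have hPv : P ≪ volume := withDensity_absolutelyContinuous _ _
  have hQv : Q ≪ volume := withDensity_absolutelyContinuous _ _
  have hvP : volume ≪ P := withDensity_absolutelyContinuous' (hdens u hu).aemeasurable
    (Filter.Eventually.of_forall fun x => (hpow _ (hu0 x)).1)
  have hvQ : volume ≪ Q := withDensity_absolutelyContinuous' (hdens v hv).aemeasurable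
    (Filter.Eventually.of_forall fun x => (hpow _ (hv0 x)).1)
  have : NullSingletonClass P := ⟨fun x => hPv (measure_singleton x)⟩
  have : NullSingletonClass Q := ⟨fun x => hQv (measure_singleton x)⟩
  have hP1 : ∀ a, P (c ⁻¹' {a}) = 1 := fun a => by
    rw [withDensity_apply _ (hc (measurableSet_singleton a))]; exact hcu a
  have hQ1 : ∀ a, Q (d ⁻¹' {a}) = 1 := fun a => by
    rw [withDensity_apply _ (hd (measurableSet_singleton a))]; exact hdv a
  -- Composition is contravariant, so carrying `u` to `v` requires a map from `v ^ r dx` to `u ^ r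
  -- dx`.
  obtain ⟨S, T, hS, hT, hTS, hcd⟩ := exists_ae_iso_of_color Q P d c hd hc hQ1 hP1
  have hSq : Measure.QuasiMeasurePreserving S volume volume :=
    hS.quasiMeasurePreserving.mono hvQ hPv
  have hTq : Measure.QuasiMeasurePreserving T volume volume :=
    hT.quasiMeasurePreserving.mono hvP hQv
  have hw : Measurable fun x => v x / u (S x) := hv.div (hu.comp hS.measurable)
  have hw0 : ∀ x, 0 < v x / u (S x) := fun x => div_pos (hv0 x) (hu0 _)
  -- With `w = v / (u ∘ S)`, the measure `w ^ r dx` is `Q` with density `u ^ (-r) ∘ S`. Its image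
  -- under `S` is `P` with density `u ^ (-r)`, which is Lebesgue measure.
  have hmp : MeasurePreserving S
      (volume.withDensity fun x => ENNReal.ofReal (v x / u (S x)) ^ r.toReal) volume := by
    have h1 : (fun x => ENNReal.ofReal (v x / u (S x)) ^ r.toReal) =
        dens v * ((dens u)⁻¹ ∘ S) := by
      funext x
      simp only [dens, Pi.mul_apply, Function.comp_apply, Pi.inv_apply]
      rw [ENNReal.ofReal_div_of_pos (hu0 _), ENNReal.div_rpow_of_nonneg _ _ hr0, div_eq_mul_inv]
    have h2 : P.withDensity (dens u)⁻¹ = volume := by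
      rw [← withDensity_mul _ (hdens u hu) (hdens u hu).inv]
      have : (dens u * (dens u)⁻¹) = 1 := by
        funext x
        exact ENNReal.mul_inv_cancel (hpow _ (hu0 x)).1 (hpow _ (hu0 x)).2
      rw [this, withDensity_one]
    have h3 := hS.withDensity_comp (hdens u hu).inv
    rw [h1, withDensity_mul _ (hdens v hv) ((hdens u hu).inv.comp hS.measurable)]
    rwa [show P.withDensity (dens u)⁻¹ = volume from h2] at h3
  refine ⟨S, fun x => v x / u (S x), ⟨hSq, fun V => ?_⟩, ?_⟩
  · intros
    exact exists_automorphism_weightedComp hr S T _ hw hw0 hSq hTq (hvQ.ae_le hTS) hmp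
  · filter_upwards [hvQ.ae_le hcd] with x hx
    exact ⟨hx, rfl⟩

theorem IsTransport.eLpNorm_comp {r : ℝ≥0∞} [Fact (1 ≤ r)] {σ : unitInterval → unitInterval}
    {w : unitInterval → ℝ} (h : IsTransport r σ w) {f : unitInterval → ℝ}
    (hf : MemLp f r volume) :
    MemLp (fun x => w x * f (σ x)) r volume ∧
      eLpNorm (fun x => w x * f (σ x)) r volume = eLpNorm f r volume := by
  obtain ⟨R, -, hR⟩ := h.exists_automorphism ℝ
  have h1 : R hf.toLp =ᵐ[volume] fun x => w x * f (σ x) := by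
    filter_upwards [hR hf.toLp, h.quasiMeasurePreserving.ae hf.coeFn_toLp] with x h1 h2
    rw [h1, h2, smul_eq_mul]
  refine ⟨(memLp_congr_ae h1).1 (Lp.memLp _), ?_⟩
  rw [← eLpNorm_congr_ae h1, ← eLpNorm_congr_ae hf.coeFn_toLp, ← Lp.enorm_def, ← Lp.enorm_def,
    ← ofReal_norm, ← ofReal_norm, R.norm_map]

-- Cut `[0, s)` into as many equal intervals as there are colours and give each interval its own
-- colour.
open unitInterval in
theorem exists_color_pos {ι : Type*} [Fintype ι] [Nonempty ι] [MeasurableSpace ι]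
    {s : ℝ} (hs : 0 < s) (hs1 : s ≤ 1) :
    ∃ β : unitInterval → ι, Measurable β ∧
      ∀ a, 0 < volume ({x : unitInterval | (x : ℝ) < s} ∩ β ⁻¹' {a}) := by
  let e := Fintype.equivFin ι
  have hk : 0 < Fintype.card ι := Fintype.card_pos
  have hk' : (0 : ℝ) < Fintype.card ι := by exact_mod_cast hk
  let g : ℕ → ι := fun n => if h : n < Fintype.card ι then e.symm ⟨n, h⟩ else e.symm ⟨0, hk⟩
  refine ⟨fun x => g ⌊(x : ℝ) * Fintype.card ι / s⌋₊, ?_, fun a => ?_⟩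
  · have h1 : Measurable g := measurable_from_top
    exact h1.comp (Nat.measurable_floor.comp (by fun_prop))
  · have ha : (e a : ℝ) + 1 ≤ Fintype.card ι := by exact_mod_cast (e a).2
    have ha0 : (0 : ℝ) ≤ (e a : ℝ) := Nat.cast_nonneg _
    have hlt : ((e a : ℝ) + 1) * s / Fintype.card ι ≤ s := by
      rw [div_le_iff₀ hk', mul_comm]
      exact mul_le_mul_of_nonneg_left ha hs.le
    have hle : (e a : ℝ) * s / Fintype.card ι < ((e a : ℝ) + 1) * s / Fintype.card ι := by
      gcongr; linarith
    let l : unitInterval := ⟨(e a : ℝ) * s / Fintype.card ι, by positivity,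
      hle.le.trans (hlt.trans hs1)⟩
    let m : unitInterval := ⟨((e a : ℝ) + 1) * s / Fintype.card ι, by positivity, hlt.trans hs1⟩
    have hpos : 0 < volume (Set.Ioo l m) := by
      rw [unitInterval.volume_Ioo]
      exact ENNReal.ofReal_pos.2 (sub_pos.2 hle)
    refine hpos.trans_le (measure_mono fun x hx => ?_)
    replace hx : (l : ℝ) < x ∧ (x : ℝ) < m := hx
    have h1 : ⌊(x : ℝ) * Fintype.card ι / s⌋₊ = (e a : ℕ) := by
      rw [Nat.floor_eq_iff (by have := x.2.1; positivity)]
      obtain ⟨h1, h2⟩ := hx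
      rw [div_lt_iff₀ hk'] at h1
      rw [lt_div_iff₀ hk'] at h2
      exact ⟨(le_div_iff₀ hs).2 h1.le, (div_lt_iff₀ hs).2 h2⟩
    refine ⟨hx.2.trans_le hlt, ?_⟩
    simp only [Set.mem_preimage, Set.mem_singleton_iff]
    rw [h1]
    simp [g]

/-- A nonnegative coloured function is a small perturbation of a positive one for which all colours
carry mass. -/
theorem exists_positive_perturbation {ι : Type*} [Fintype ι] [Nonempty ι] [MeasurableSpace ι]
    [MeasurableSingletonClass ι] (r : ℝ≥0∞) [Fact (1 ≤ r)] (hr : r ≠ ∞)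
    {u : unitInterval → ℝ} {c : unitInterval → ι} (hu : Measurable u) (hu0 : ∀ x, 0 ≤ u x)
    (hur : MemLp u r volume) (hc : Measurable c) {ε : ℝ} (hε : 0 < ε) :
    ∃ (u' : unitInterval → ℝ) (c' : unitInterval → ι), Measurable u' ∧ Measurable c' ∧
      (∀ x, 0 < u' x) ∧ MemLp u' r volume ∧
      ∀ a, eLpNorm ((c' ⁻¹' {a}).indicator u') r volume ≠ 0 ∧
        eLpNorm ((c' ⁻¹' {a}).indicator u' - (c ⁻¹' {a}).indicator u) r volume ≤
          ENNReal.ofReal ε := by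
  have hr1 : 1 ≤ r := Fact.out
  have hr0 : r ≠ 0 := (lt_of_lt_of_le zero_lt_one hr1).ne'
  obtain ⟨δ, hδ, hδu⟩ := hur.eLpNorm_indicator_le hr1 hr (half_pos hε)
  set s : ℝ := min δ 1 with hs
  have hs0 : 0 < s := lt_min hδ zero_lt_one
  obtain ⟨β, hβ, hβ0⟩ := exists_color_pos (ι := ι) hs0 (min_le_right _ _)
  let B : Set unitInterval := {x | (x : ℝ) < s}
  have hB : MeasurableSet B := measurableSet_lt measurable_subtype_coe measurable_const
  have hBv : volume B ≤ ENNReal.ofReal δ := by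
    have : B ⊆ Set.Iic ⟨s, hs0.le, min_le_right _ _⟩ := fun x hx =>
      show (x : ℝ) ≤ s from le_of_lt hx
    refine (measure_mono this).trans ?_
    rw [unitInterval.volume_Iic]
    exact ENNReal.ofReal_le_ofReal (min_le_left _ _)
  -- On `B`, which is small but meets every colour, and on the zero set, `u` is replaced by the
  -- constant `ε / 2`. The change is at most `ε / 2` plus `u` restricted to `B`, and `B` was chosen
  -- so that the latter has norm at most `ε / 2`.
  let Z : Set unitInterval := B ∪ u ⁻¹' {0}
  have hZ : MeasurableSet Z := hB.union (hu (measurableSet_singleton 0))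
  classical
  let u' : unitInterval → ℝ := Z.piecewise (fun _ => ε / 2) u
  let c' : unitInterval → ι := Z.piecewise β c
  have hu' : Measurable u' := measurable_const.piecewise hZ hu
  have hc' : Measurable c' := hβ.piecewise hZ hc
  have hu'0 : ∀ x, 0 < u' x := fun x => by
    by_cases hx : x ∈ Z
    · simp only [u', Set.piecewise_eq_of_mem _ _ _ hx]; linarith
    · simp only [u', Set.piecewise_eq_of_notMem _ _ _ hx]
      exact lt_of_le_of_ne (hu0 x) fun h => hx (Or.inr h.symm)
  have hu'r : MemLp u' r volume := by
    refine MemLp.mono' ((memLp_const (ε / 2)).add hur) hu'.aestronglyMeasurable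
      (Filter.Eventually.of_forall fun x => ?_)
    rw [Real.norm_of_nonneg (hu'0 x).le, Pi.add_apply]
    have := hu0 x
    by_cases hx : x ∈ Z
    · simp only [u', Set.piecewise_eq_of_mem _ _ _ hx]; linarith
    · simp only [u', Set.piecewise_eq_of_notMem _ _ _ hx]; linarith
  refine ⟨u', c', hu', hc', hu'0, hu'r, fun a => ⟨?_, ?_⟩⟩
  · rw [Ne, eLpNorm_eq_zero_iff (hu'.indicator (hc' (measurableSet_singleton a))).aestronglyMeasurable
      hr0]
    intro h
    have h2 : volume (c' ⁻¹' {a}) = 0 := by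
      refine measure_mono_null (fun x hx => ?_) h
      change ¬ ((c' ⁻¹' {a}).indicator u' x = 0)
      rw [Set.indicator_of_mem hx]
      exact (hu'0 x).ne'
    refine (hβ0 a).ne' (measure_mono_null (fun x hx => ?_) h2)
    have hxZ : x ∈ Z := Or.inl hx.1
    change c' x = a
    simp only [c', Set.piecewise_eq_of_mem _ _ _ hxZ]
    exact hx.2
  · calc eLpNorm ((c' ⁻¹' {a}).indicator u' - (c ⁻¹' {a}).indicator u) r volume
        ≤ eLpNorm ((fun _ => ε / 2) + B.indicator u) r volume := by
          refine eLpNorm_mono_real fun x => ?_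
          have h0 := hu0 x
          have hb : 0 ≤ B.indicator u x := Set.indicator_nonneg (fun y _ => hu0 y) x
          simp only [Pi.sub_apply, Pi.add_apply, Real.norm_eq_abs]
          by_cases hx : x ∈ Z
          · have h1 : u' x = ε / 2 := Set.piecewise_eq_of_mem _ _ _ hx
            have h2 : (c ⁻¹' {a}).indicator u x ≤ B.indicator u x := by
              rcases hx with hx | hx
              · rw [Set.indicator_of_mem hx]
                exact Set.indicator_le_self' (fun _ _ => hu0 _) x
              · have hx' : u x = 0 := hx
                rw [Set.indicator_apply, hx', ite_self]; exact hb
            have h3 : 0 ≤ (c ⁻¹' {a}).indicator u x := Set.indicator_nonneg (fun y _ => hu0 y) x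
            have h4 : 0 ≤ (c' ⁻¹' {a}).indicator u' x :=
              Set.indicator_nonneg (fun y _ => (hu'0 y).le) x
            have h5 : (c' ⁻¹' {a}).indicator u' x ≤ ε / 2 := by
              rw [← h1]; exact Set.indicator_le_self' (fun _ _ => (hu'0 _).le) x
            rw [abs_le]; constructor <;> linarith
          · have h1 : u' x = u x := Set.piecewise_eq_of_notMem _ _ _ hx
            have h2 : c' x = c x := Set.piecewise_eq_of_notMem _ _ _ hx
            simp only [Set.indicator_apply, Set.mem_preimage, h1, h2, sub_self, abs_zero]
            simp only [Set.indicator_apply] at hb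
            linarith
      _ ≤ eLpNorm (fun _ : unitInterval => ε / 2) r volume + eLpNorm (B.indicator u) r volume :=
          eLpNorm_add_le aestronglyMeasurable_const (hu.indicator hB).aestronglyMeasurable hr1
      _ ≤ ENNReal.ofReal (ε / 2) + ENNReal.ofReal (ε / 2) := by
          refine add_le_add ?_ (hδu B hB hBv)
          rw [eLpNorm_const _ hr0 (NeZero.ne _)]
          simp [Real.enorm_eq_ofReal (half_pos hε).le]
      _ = ENNReal.ofReal ε := by
          rw [← ENNReal.ofReal_add (half_pos hε).le (half_pos hε).le, add_halves]

theorem abs_toReal_eLpNorm_sub_le {α : Type*} [MeasurableSpace α] {μ : Measure α} {r : ℝ≥0∞}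
    [Fact (1 ≤ r)] {f g : α → ℝ} (hf : MemLp f r μ) (hg : MemLp g r μ) {δ : ℝ} (hδ : 0 ≤ δ)
    (h : eLpNorm (f - g) r μ ≤ ENNReal.ofReal δ) :
    |(eLpNorm f r μ).toReal - (eLpNorm g r μ).toReal| ≤ δ := by
  have h1 := abs_norm_sub_norm_le hf.toLp hg.toLp
  rw [← MemLp.toLp_sub hf hg, Lp.norm_toLp, Lp.norm_toLp, Lp.norm_toLp] at h1
  exact h1.trans (ENNReal.toReal_le_of_le_ofReal hδ h)

/-- Dividing by the norm on each colour brings all colours to mass one, the form in which exact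
transport applies. -/
theorem lintegral_normalized_eq_one {ι : Type*} [Finite ι] [MeasurableSpace ι]
    [MeasurableSingletonClass ι] (r : ℝ≥0∞) [Fact (1 ≤ r)] (hr : r ≠ ∞)
    {u : unitInterval → ℝ} {c : unitInterval → ι} (hc : Measurable c)
    (hu0 : ∀ x, 0 < u x) (n : ι → ℝ) (hn : ∀ a, 0 < n a)
    (hcn : ∀ a, eLpNorm ((c ⁻¹' {a}).indicator u) r volume = ENNReal.ofReal (n a)) (a : ι) :
    ∫⁻ x in c ⁻¹' {a}, ENNReal.ofReal (u x / n (c x)) ^ r.toReal = 1 := by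
  have hr0 : r ≠ 0 := (lt_of_lt_of_le zero_lt_one (Fact.out : 1 ≤ r)).ne'
  have hrr : r.toReal ≠ 0 := (ENNReal.toReal_pos hr0 hr).ne'
  have hA : MeasurableSet (c ⁻¹' {a}) := hc (measurableSet_singleton a)
  have h1 := hcn a
  rw [eLpNorm_indicator_eq_eLpNorm_restrict hA, eLpNorm_eq_lintegral_rpow_enorm_toReal hr0 hr,
    one_div] at h1
  replace h1 := congrArg (· ^ r.toReal) h1
  simp only [ENNReal.rpow_inv_rpow hrr] at h1
  have hna : ENNReal.ofReal (n a) ^ r.toReal ≠ 0 :=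
    (ENNReal.rpow_pos (ENNReal.ofReal_pos.2 (hn a)) ENNReal.ofReal_ne_top).ne'
  have hna' : ENNReal.ofReal (n a) ^ r.toReal ≠ ∞ :=
    ENNReal.rpow_ne_top_of_nonneg ENNReal.toReal_nonneg ENNReal.ofReal_ne_top
  have h2 : ∫⁻ x in c ⁻¹' {a}, ENNReal.ofReal (u x / n (c x)) ^ r.toReal =
      ∫⁻ x in c ⁻¹' {a}, ‖u x‖ₑ ^ r.toReal * (ENNReal.ofReal (n a) ^ r.toReal)⁻¹ := by
    refine setLIntegral_congr_fun hA fun x hx => ?_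
    have hx' : c x = a := hx
    rw [hx', ENNReal.ofReal_div_of_pos (hn a), ENNReal.div_rpow_of_nonneg _ _
      ENNReal.toReal_nonneg, div_eq_mul_inv, Real.enorm_eq_ofReal (hu0 x).le]
  rw [h2, lintegral_mul_const' _ _ (ENNReal.inv_ne_top.2 hna), h1, ENNReal.mul_inv_cancel hna hna']

/-- Approximate transitivity of the transports on finite disjoint families in `L_r`. -/
theorem exists_isTransport_approx {ι : Type*} [Fintype ι] [Nonempty ι] [MeasurableSpace ι]
    [MeasurableSingletonClass ι] (r : ℝ≥0∞) [Fact (1 ≤ r)] (hr : r ≠ ∞)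
    {u v : unitInterval → ℝ} {c d : unitInterval → ι} (hu : Measurable u) (hv : Measurable v)
    (hu0 : ∀ x, 0 ≤ u x) (hv0 : ∀ x, 0 ≤ v x) (hur : MemLp u r volume) (hvr : MemLp v r volume)
    (hc : Measurable c) (hd : Measurable d) {ε : ℝ} (hε : 0 < ε) :
    ∃ σ w, IsTransport r σ w ∧ ∀ a,
      eLpNorm (fun x => w x * (c ⁻¹' {a}).indicator u (σ x) - (d ⁻¹' {a}).indicator v x) r volume
        ≤ ENNReal.ofReal (|(eLpNorm ((c ⁻¹' {a}).indicator u) r volume).toReal -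
          (eLpNorm ((d ⁻¹' {a}).indicator v) r volume).toReal| + ε) := by
  classical
  have hr1 : 1 ≤ r := Fact.out
  -- Each of the two perturbations costs `δ` directly and another `δ` in the comparison of the
  -- norms.
  set δ : ℝ := ε / 4 with hδ
  have hδ0 : 0 < δ := by positivity
  obtain ⟨u', c', hu', hc', hu'0, hu'r, hcu⟩ :=
    exists_positive_perturbation r hr hu hu0 hur hc hδ0
  obtain ⟨v', d', hv', hd', hv'0, hv'r, hdv⟩ :=
    exists_positive_perturbation r hr hv hv0 hvr hd hδ0
  have hF : ∀ a, MemLp ((c' ⁻¹' {a}).indicator u') r volume := fun a =>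
    hu'r.indicator (hc' (measurableSet_singleton a))
  have hG : ∀ a, MemLp ((d' ⁻¹' {a}).indicator v') r volume := fun a =>
    hv'r.indicator (hd' (measurableSet_singleton a))
  have hf : ∀ a, MemLp ((c ⁻¹' {a}).indicator u) r volume := fun a =>
    hur.indicator (hc (measurableSet_singleton a))
  have hg : ∀ a, MemLp ((d ⁻¹' {a}).indicator v) r volume := fun a =>
    hvr.indicator (hd (measurableSet_singleton a))
  let n : ι → ℝ := fun a => (eLpNorm ((c' ⁻¹' {a}).indicator u') r volume).toReal
  let m : ι → ℝ := fun a => (eLpNorm ((d' ⁻¹' {a}).indicator v') r volume).toReal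
  have hn0 : ∀ a, 0 < n a := fun a => ENNReal.toReal_pos (hcu a).1 (hF a).eLpNorm_ne_top
  have hm0 : ∀ a, 0 < m a := fun a => ENNReal.toReal_pos (hdv a).1 (hG a).eLpNorm_ne_top
  have hn : ∀ a, eLpNorm ((c' ⁻¹' {a}).indicator u') r volume = ENNReal.ofReal (n a) := fun a =>
    (ENNReal.ofReal_toReal (hF a).eLpNorm_ne_top).symm
  have hm : ∀ a, eLpNorm ((d' ⁻¹' {a}).indicator v') r volume = ENNReal.ofReal (m a) := fun a =>
    (ENNReal.ofReal_toReal (hG a).eLpNorm_ne_top).symm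
  obtain ⟨σ, w, hT, hw⟩ := exists_isTransport_of_lintegral_eq_one r hr
    (u := fun x => u' x / n (c' x)) (v := fun x => v' x / m (d' x))
    (hu'.div ((measurable_of_finite n).comp hc')) (hv'.div ((measurable_of_finite m).comp hd'))
    (fun x => div_pos (hu'0 x) (hn0 _)) (fun x => div_pos (hv'0 x) (hm0 _)) hc' hd'
    (lintegral_normalized_eq_one r hr hc' hu'0 n hn0 hn)
    (lintegral_normalized_eq_one r hr hd' hv'0 m hm0 hm)
  refine ⟨σ, w, hT, fun a => ?_⟩
  have hFf := hT.eLpNorm_comp ((hf a).sub (hF a))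
  have e1 : eLpNorm (fun x => w x * (c' ⁻¹' {a}).indicator u' (σ x) -
      (d' ⁻¹' {a}).indicator v' x) r volume = ENNReal.ofReal |n a - m a| := by
    -- The transport matches the normalised functions exactly, so on colour `a` it sends `u'` to `(n
    -- a / m a) v'`; the remaining distance is `|n a - m a|`.
    have : (fun x => w x * (c' ⁻¹' {a}).indicator u' (σ x) - (d' ⁻¹' {a}).indicator v' x)
        =ᵐ[volume] (n a / m a - 1) • (d' ⁻¹' {a}).indicator v' := by
      filter_upwards [hw] with x hx
      obtain ⟨hx1, hx2⟩ := hx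
      simp only [Set.indicator_apply, Set.mem_preimage, Set.mem_singleton_iff, Pi.smul_apply,
        smul_eq_mul, hx1, hx2]
      split_ifs with h
      · rw [h]
        have := (hu'0 (σ x)).ne'
        have := (hn0 a).ne'
        have := (hm0 a).ne'
        field_simp
      · simp
    rw [eLpNorm_congr_ae this, eLpNorm_const_smul, hm, Real.enorm_eq_ofReal_abs,
      ← ENNReal.ofReal_mul (abs_nonneg _)]
    congr 1
    rw [← abs_of_pos (hm0 a), ← abs_mul, abs_of_pos (hm0 a), sub_mul, one_mul,
      div_mul_cancel₀ _ (hm0 a).ne']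
  have e2 : eLpNorm (fun x => w x * ((c ⁻¹' {a}).indicator u - (c' ⁻¹' {a}).indicator u') (σ x)) r
      volume ≤ ENNReal.ofReal δ := by
    rw [hFf.2, eLpNorm_sub_comm]; exact (hcu a).2
  have e3 := (hdv a).2
  have hsplit : (fun x => w x * (c ⁻¹' {a}).indicator u (σ x) - (d ⁻¹' {a}).indicator v x) =
      (fun x => w x * ((c ⁻¹' {a}).indicator u - (c' ⁻¹' {a}).indicator u') (σ x)) +
      ((fun x => w x * (c' ⁻¹' {a}).indicator u' (σ x) - (d' ⁻¹' {a}).indicator v' x) +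
      ((d' ⁻¹' {a}).indicator v' - (d ⁻¹' {a}).indicator v)) := by
    funext x
    simp only [Pi.add_apply, Pi.sub_apply]
    ring
  have hm1 := ((hT.eLpNorm_comp (hF a)).1.sub (hG a)).1
  have hm2 := ((hG a).sub (hg a)).1
  have b1 := abs_toReal_eLpNorm_sub_le (hF a) (hf a) hδ0.le (hcu a).2
  have b2 := abs_toReal_eLpNorm_sub_le (hG a) (hg a) hδ0.le (hdv a).2
  rw [hsplit]
  calc _ ≤ ENNReal.ofReal δ + (ENNReal.ofReal |n a - m a| + ENNReal.ofReal δ) := by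
        refine (eLpNorm_add_le hFf.1.1 (hm1.add hm2) hr1).trans (add_le_add e2 ?_)
        exact (eLpNorm_add_le hm1 hm2 hr1).trans (add_le_add e1.le e3)
    _ = ENNReal.ofReal (δ + (|n a - m a| + δ)) := by
        rw [← ENNReal.ofReal_add (abs_nonneg _) hδ0.le, ← ENNReal.ofReal_add hδ0.le (by positivity)]
    _ ≤ _ := by
        refine ENNReal.ofReal_le_ofReal ?_
        have : |n a - m a| ≤ |(eLpNorm ((c ⁻¹' {a}).indicator u) r volume).toReal -
          (eLpNorm ((d ⁻¹' {a}).indicator v) r volume).toReal| + 2 * δ := by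
          rw [abs_le] at b1 b2
          rw [abs_le]
          change _ ≤ n a - _ ∧ n a - _ ≤ _ at b1
          change _ ≤ m a - _ ∧ m a - _ ≤ _ at b2
          have h1 := le_abs_self ((eLpNorm ((c ⁻¹' {a}).indicator u) r volume).toReal -
            (eLpNorm ((d ⁻¹' {a}).indicator v) r volume).toReal)
          have h2 := neg_abs_le ((eLpNorm ((c ⁻¹' {a}).indicator u) r volume).toReal -
            (eLpNorm ((d ⁻¹' {a}).indicator v) r volume).toReal)
          constructor <;> linarith [b1.1, b1.2, b2.1, b2.2]
        linarith

/-! ### Power integrals with non-natural exponent determine laws -/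

/-- The numerator `a (a - 1) ⋯ (a - n + 1)` vanishes only at natural numbers. -/
theorem Ring.choose_real_ne_zero {a : ℝ} (ha : ∀ k : ℕ, a ≠ k) (n : ℕ) : Ring.choose a n ≠ 0 := by
  rw [Ring.choose_eq_smul, Polynomial.descPochhammer_smeval_eq_ascPochhammer,
    Polynomial.ascPochhammer_smeval_cast, Polynomial.ascPochhammer_smeval_eq_eval]
  refine smul_ne_zero (by positivity) ?_
  rw [Ne, ascPochhammer_eval_eq_zero_iff]
  rintro ⟨k, hk, h⟩
  refine ha (n - 1 - k) ?_
  have h1 : ((n - 1 - k : ℕ) : ℝ) = n - 1 - k := by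
    rw [Nat.sub_sub, Nat.cast_sub (by omega)]; push_cast; ring
  rw [h1]; linarith

/-- Integration of a power series in a bounded function. -/
theorem hasSum_integral_powerSeries {𝕜 Ω : Type*} [RCLike 𝕜] [MeasurableSpace Ω] {ν : Measure Ω}
    [IsFiniteMeasure ν] {ξ : Ω → ℝ} (hξ : Measurable ξ) {C : ℝ} (hC : ∀ x, |ξ x| ≤ C)
    {c : ℕ → 𝕜} {f : Ω → 𝕜} (hc : Summable fun k => ‖c k‖ * C ^ k)
    (hf : ∀ x, HasSum (fun k => c k * (ξ x : 𝕜) ^ k) (f x)) :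
    HasSum (fun k => c k * ((∫ x, ξ x ^ k ∂ν : ℝ) : 𝕜)) (∫ x, f x ∂ν) := by
  have hpow : ∀ k x, ‖ξ x ^ k‖ ≤ C ^ k := fun k x => by
    rw [norm_pow]; exact pow_le_pow_left₀ (norm_nonneg _) (hC x) k
  have hint : ∀ k, Integrable (fun x => ξ x ^ k) ν := fun k =>
    Integrable.of_bound (hξ.pow_const k).aestronglyMeasurable (C ^ k)
      (Filter.Eventually.of_forall (hpow k))
  have h := hasSum_integral_of_summable_integral_norm (μ := ν)
    (F := fun k x => c k * ((ξ x ^ k : ℝ) : 𝕜))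
    (fun k => ((hint k).ofReal).const_mul _) ?_
  · convert! h using 1
    · funext k
      rw [integral_const_mul, integral_ofReal]
    · refine integral_congr_ae (Filter.Eventually.of_forall fun x => ?_)
      have := (hf x).tsum_eq
      push_cast
      exact this.symm
  · refine Summable.of_nonneg_of_le (fun k => integral_nonneg fun x => norm_nonneg _) (fun k => ?_)
      (hc.mul_right (ν.real Set.univ))
    have : ∀ x, ‖c k * ((ξ x ^ k : ℝ) : 𝕜)‖ ≤ ‖c k‖ * C ^ k := fun x => by
      rw [norm_mul, RCLike.norm_ofReal]
      exact mul_le_mul_of_nonneg_left (hpow k x) (norm_nonneg _)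
    calc _ ≤ ∫ _, ‖c k‖ * C ^ k ∂ν := integral_mono_of_nonneg
            (Filter.Eventually.of_forall fun x => norm_nonneg _) (integrable_const _)
            (Filter.Eventually.of_forall this)
      _ = _ := by simp [mul_comm]

open Filter Topology in
/-- For a non-natural exponent, the power integrals near `1` determine all moments. -/
theorem moments_eq_of_integral_one_add_rpow_eq {Ω : Type*} [MeasurableSpace Ω]
    {ν ν' : Measure Ω} [IsFiniteMeasure ν] [IsFiniteMeasure ν']
    {ξ ξ' : Ω → ℝ} (hξ : Measurable ξ) (hξ' : Measurable ξ') {C : ℝ} (hC0 : 0 < C)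
    (hC : ∀ x, |ξ x| ≤ C) (hC' : ∀ x, |ξ' x| ≤ C) {α : ℝ} (hα : ∀ k : ℕ, α ≠ k)
    (h : ∀ r : ℝ, |r| * C < 1 → ∫ x, (1 + r * ξ x) ^ α ∂ν = ∫ x, (1 + r * ξ' x) ^ α ∂ν') (k : ℕ) :
    ∫ x, ξ x ^ k ∂ν = ∫ x, ξ' x ^ k ∂ν' := by
  have hbin : ∀ x : ℝ, |x| < 1 → HasSum (fun n => Ring.choose α n * x ^ n) ((1 + x) ^ α) := by
    intro x hx
    have hx' : x ∈ Metric.eball (0 : ℝ) 1 := by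
      rw [mem_eball_zero_iff, ← ofReal_norm, Real.norm_eq_abs]
      exact ENNReal.ofReal_lt_one.2 hx
    have := (Real.one_add_rpow_hasFPowerSeriesOnBall_zero (a := α)).hasSum hx'
    simpa only [binomialSeries_apply, List.ofFn_const, List.prod_replicate, smul_eq_mul,
      zero_add] using this
  have hone : ∀ {ν : Measure Ω} [IsFiniteMeasure ν] {ξ : Ω → ℝ},
      Measurable ξ → (∀ x, |ξ x| ≤ C) → ∀ r : ℝ, |r| * C < 1 →
      HasSum (fun n => Ring.choose α n * r ^ n * ∫ x, ξ x ^ n ∂ν) (∫ x, (1 + r * ξ x) ^ α ∂ν) := by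
    intro ν _ ξ hξ hC r hr
    refine hasSum_integral_powerSeries (𝕜 := ℝ) (c := fun n => Ring.choose α n * r ^ n) hξ hC ?_ ?_
    · have h1 : |(|r| * C)| < 1 := by rwa [abs_of_nonneg (by positivity)]
      have h2 := (hbin _ h1).summable.norm
      refine h2.congr fun n => ?_
      rw [norm_mul, norm_mul, mul_pow, norm_mul, norm_pow, norm_pow, norm_pow, Real.norm_eq_abs |r|,
        abs_abs, Real.norm_of_nonneg hC0.le, mul_assoc]
      rfl
    · intro x
      have h1 : |r * ξ x| < 1 := by
        rw [abs_mul]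
        exact (mul_le_mul_of_nonneg_left (hC x) (abs_nonneg _)).trans_lt hr
      convert! hbin _ h1 using 2 with n
      rw [mul_pow, ← mul_assoc]; rfl
  -- The difference of the two binomial expansions is a power series in `r` representing zero near
  -- the origin, so each coefficient, a nonzero binomial coefficient times a difference of moments,
  -- is zero.
  let p : FormalMultilinearSeries ℝ ℝ ℝ := FormalMultilinearSeries.ofScalars ℝ fun n =>
    Ring.choose α n * (∫ x, ξ x ^ n ∂ν - ∫ x, ξ' x ^ n ∂ν')
  have hp : HasFPowerSeriesAt (0 : ℝ → ℝ) p 0 := by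
    rw [hasFPowerSeriesAt_iff]
    have hnear : ∀ᶠ r : ℝ in 𝓝 0, |r| * C < 1 := by
      have : Continuous fun r : ℝ => |r| * C := by fun_prop
      exact (this.tendsto 0).eventually (gt_mem_nhds (by simp))
    filter_upwards [hnear] with r hr
    have h1 := (hone hξ hC r hr (ν := ν)).sub (hone hξ' hC' r hr (ν := ν'))
    rw [h r hr, sub_self] at h1
    convert! h1 using 2 with n
    rw [FormalMultilinearSeries.coeff_ofScalars, smul_eq_mul]
    ring
  have h0 : p.coeff k = 0 := by
    rw [hp.eq_zero]; rfl
  rw [FormalMultilinearSeries.coeff_ofScalars] at h0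
  rcases mul_eq_zero.1 h0 with h1 | h1
  · exact absurd h1 (Ring.choose_real_ne_zero hα k)
  · exact sub_eq_zero.1 h1

/-- A bounded random vector is determined by the moments of its linear functionals. -/
theorem map_eq_of_moments_eq {Ω B : Type*} [Fintype B] [MeasurableSpace Ω]
    {ν ν' : Measure Ω} [IsFiniteMeasure ν] [IsFiniteMeasure ν']
    {z z' : Ω → EuclideanSpace ℝ B} (hz : Measurable z)
    (hz' : Measurable z') {C : ℝ} (hC : ∀ x, ‖z x‖ ≤ C) (hC' : ∀ x, ‖z' x‖ ≤ C)
    (h : ∀ (t : EuclideanSpace ℝ B) (k : ℕ),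
      ∫ x, (inner ℝ (z x) t : ℝ) ^ k ∂ν = ∫ x, (inner ℝ (z' x) t : ℝ) ^ k ∂ν') :
    ν.map z = ν'.map z' := by
  -- Boundedness allows the exponential series to be integrated termwise, which writes the
  -- characteristic function in terms of the moments.
  have key : ∀ {ν : Measure Ω} [IsFiniteMeasure ν]
      {z : Ω → EuclideanSpace ℝ B}, Measurable z → (∀ x, ‖z x‖ ≤ C) →
      ∀ t, HasSum (fun k : ℕ => (Complex.I ^ k / k.factorial) *
        ((∫ x, (inner ℝ (z x) t : ℝ) ^ k ∂ν : ℝ) : ℂ)) (charFun (ν.map z) t) := by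
    intro ν _ z hz hC t
    rw [charFun_apply, integral_map hz.aemeasurable (by fun_prop)]
    refine hasSum_integral_powerSeries (𝕜 := ℂ) (C := C * ‖t‖)
      (hz.inner measurable_const) (fun x => ?_) ?_ fun x => ?_
    · exact (abs_real_inner_le_norm _ _).trans
        (mul_le_mul_of_nonneg_right (hC x) (norm_nonneg _))
    · refine (Real.summable_pow_div_factorial (C * ‖t‖)).congr fun k => ?_
      simp [div_eq_inv_mul]
    · have := NormedSpace.expSeries_div_hasSum_exp ((inner ℝ (z x) t : ℂ) * Complex.I)
      rw [← Complex.exp_eq_exp_ℂ] at this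
      convert! this using 2 with k
      simp only [mul_pow, Complex.coe_algebraMap]
      ring
  have : IsFiniteMeasure (ν.map z) := Measure.isFiniteMeasure_map ν z
  have : IsFiniteMeasure (ν'.map z') := Measure.isFiniteMeasure_map ν' z'
  refine Measure.ext_of_charFun (funext fun t => ?_)
  have h1 := key hz hC t (ν := ν)
  simp only [h] at h1
  exact h1.unique (key hz' hC' t)

/-- By homogeneity, the power of a nonnegative combination of `w` splits into the density `(∑ w) ^
α` and the power of a linear functional of the normalised vector. If `∑ w = 0`, every `w b` vanishes
and division by zero does no harm. -/
theorem sum_mul_rpow_eq {B : Type*} [Fintype B] {α : ℝ} {w s : B → ℝ}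
    (hw : ∀ b, 0 ≤ w b) (hs : ∀ b, 0 ≤ s b) :
    (∑ b, w b) ^ α * (∑ b, s b * (w b / ∑ b, w b)) ^ α = (∑ b, s b * w b) ^ α := by
  have hW : 0 ≤ ∑ b, w b := Finset.sum_nonneg fun b _ => hw b
  rw [← Real.mul_rpow hW (Finset.sum_nonneg fun b _ => mul_nonneg (hs b) (div_nonneg (hw b) hW)),
    Finset.mul_sum]
  congr 1
  refine Finset.sum_congr rfl fun b _ => ?_
  rcases hW.eq_or_lt with h | h
  · have : w b = 0 := (Finset.sum_eq_zero_iff_of_nonneg fun b _ => hw b).1 h.symm b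
      (Finset.mem_univ b)
    simp [this]
  · field_simp

/-- For a non-natural exponent `α`, the integrals of `(∑ s b * w b) ^ α`, `s ≥ 0`, determine the
law of the normalised vector `w / ∑ w` with respect to the density `(∑ w) ^ α`. -/
theorem setLIntegral_eq_of_integral_rpow_eq {Ω B : Type*} [Fintype B] [MeasurableSpace Ω]
    {μ : Measure Ω} {α : ℝ} (hα0 : 0 < α) (hα : ∀ k : ℕ, α ≠ k) {w w' : Ω → B → ℝ}
    (hw : Measurable w) (hw' : Measurable w') (hw0 : ∀ x b, 0 ≤ w x b) (hw0' : ∀ x b, 0 ≤ w' x b)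
    (hi : Integrable (fun x => (∑ b, w x b) ^ α) μ) (hi' : Integrable (fun x => (∑ b, w' x b) ^ α) μ)
    (h : ∀ s : B → ℝ, (∀ b, 0 ≤ s b) →
      ∫ x, (∑ b, s b * w x b) ^ α ∂μ = ∫ x, (∑ b, s b * w' x b) ^ α ∂μ)
    {D : Set (B → ℝ)} (hD : MeasurableSet D) :
    ∫⁻ x in {x | (fun b => w x b / ∑ b, w x b) ∈ D}, ENNReal.ofReal ((∑ b, w x b) ^ α) ∂μ =
      ∫⁻ x in {x | (fun b => w' x b / ∑ b, w' x b) ∈ D}, ENNReal.ofReal ((∑ b, w' x b) ^ α) ∂μ := by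
  let z : (Ω → B → ℝ) → Ω → EuclideanSpace ℝ B := fun w x =>
    WithLp.toLp 2 fun b => w x b / ∑ b, w x b
  let ν : (Ω → B → ℝ) → Measure Ω := fun w =>
    μ.withDensity fun x => ENNReal.ofReal ((∑ b, w x b) ^ α)
  have hWm : ∀ {w : Ω → B → ℝ}, Measurable w → Measurable fun x => ∑ b, w x b := fun hw =>
    Finset.measurable_sum _ fun b _ => (measurable_pi_apply b).comp hw
  have hzm' : ∀ {w : Ω → B → ℝ}, Measurable w → Measurable fun x b => w x b / ∑ b, w x b :=
    fun hw => measurable_pi_lambda _ fun b => ((measurable_pi_apply b).comp hw).div (hWm hw)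
  have hzm : ∀ {w : Ω → B → ℝ}, Measurable w → Measurable (z w) := fun hw =>
    (MeasurableEquiv.toLp 2 (B → ℝ)).measurable.comp (hzm' hw)
  have hz1 : ∀ {w : Ω → B → ℝ}, (∀ x b, 0 ≤ w x b) → ∀ x, ‖z w x‖ ≤ 1 := by
    intro w hw0 x
    have hW : 0 ≤ ∑ b, w x b := Finset.sum_nonneg fun b _ => hw0 x b
    rw [EuclideanSpace.norm_eq, Real.sqrt_le_one]
    calc ∑ b, ‖w x b / ∑ b, w x b‖ ^ 2 ≤ ∑ b, w x b / ∑ b, w x b := by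
          refine Finset.sum_le_sum fun b _ => ?_
          have h0 : 0 ≤ w x b / ∑ b, w x b := div_nonneg (hw0 x b) hW
          have h1 : w x b / ∑ b, w x b ≤ 1 := div_le_one_of_le₀
            (Finset.single_le_sum (fun b _ => hw0 x b) (Finset.mem_univ b)) hW
          rw [Real.norm_of_nonneg h0]
          nlinarith
      _ ≤ 1 := by rw [← Finset.sum_div]; exact div_self_le_one _
  have hfin : ∀ {w : Ω → B → ℝ}, Integrable (fun x => (∑ b, w x b) ^ α) μ →
      IsFiniteMeasure (ν w) := fun hi => isFiniteMeasure_withDensity_ofReal hi.2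
  -- The test coefficients are `s = 1 + r t`, nonnegative for small `r`. Adding `1` to `‖t‖` keeps
  -- the bound positive when `t = 0`.
  have hcoef : ∀ (t : EuclideanSpace ℝ B) (r : ℝ), |r| * (‖t‖ + 1) < 1 →
      ∀ b, 0 ≤ 1 + r * t b := fun t r hr b => by
    have h1 : |r * t b| ≤ 1 := by
      rw [abs_mul]
      refine le_trans (mul_le_mul_of_nonneg_left ?_ (abs_nonneg r)) hr.le
      have := PiLp.norm_apply_le t b
      rw [Real.norm_eq_abs] at this
      linarith
    linarith [neg_le_of_abs_le h1]
  -- Where `∑ w > 0` the normalised coordinates sum to one, so `∑ (1 + r t b) z b = 1 + r ⟨z, t⟩`;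
  -- elsewhere the density vanishes because `α > 0`.
  have hint : ∀ {w : Ω → B → ℝ}, Measurable w → (∀ x b, 0 ≤ w x b) →
      ∀ (t : EuclideanSpace ℝ B) (r : ℝ), |r| * (‖t‖ + 1) < 1 →
      ∫ x, (1 + r * inner ℝ (z w x) t) ^ α ∂(ν w) = ∫ x, (∑ b, (1 + r * t b) * w x b) ^ α ∂μ := by
    intro w hw hw0 t r hr
    have hs := hcoef t r hr
    have hm : Measurable fun x => ((∑ b, w x b) ^ α).toNNReal :=
      ((hWm hw).pow_const _).real_toNNReal
    change ∫ x, _ ∂(μ.withDensity fun x => (((∑ b, w x b) ^ α).toNNReal : ℝ≥0∞)) = _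
    rw [integral_withDensity_eq_integral_smul hm]
    refine integral_congr_ae (Filter.Eventually.of_forall fun x => ?_)
    have hW : 0 ≤ ∑ b, w x b := Finset.sum_nonneg fun b _ => hw0 x b
    simp only [NNReal.smul_def, Real.coe_toNNReal _ (Real.rpow_nonneg hW α), smul_eq_mul]
    rcases hW.eq_or_lt with h0 | h0
    · have : ∀ b, w x b = 0 := fun b =>
        (Finset.sum_eq_zero_iff_of_nonneg fun b _ => hw0 x b).1 h0.symm b (Finset.mem_univ b)
      simp [this, Real.zero_rpow hα0.ne']
    · rw [← sum_mul_rpow_eq (hw0 x) hs]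
      congr 2
      simp only [add_mul, one_mul, Finset.sum_add_distrib]
      rw [← Finset.sum_div, div_self h0.ne', PiLp.inner_apply, Finset.mul_sum]
      congr 1
      refine Finset.sum_congr rfl fun b _ => ?_
      simp only [z, RCLike.inner_apply, conj_trivial]
      ring
  have hfw := hfin hi
  have hfw' := hfin hi'
  have hmap : (ν w).map (z w) = (ν w').map (z w') := by
    refine map_eq_of_moments_eq (hzm hw) (hzm hw') (hz1 hw0) (hz1 hw0') fun t k => ?_
    have hb : ∀ {w : Ω → B → ℝ}, (∀ x b, 0 ≤ w x b) → ∀ x,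
        |(inner ℝ (z w x) t : ℝ)| ≤ ‖t‖ + 1 := fun {w} hw0 x => by
      have h1 := abs_real_inner_le_norm (z w x) t
      have h2 := mul_le_mul_of_nonneg_right (hz1 hw0 x) (norm_nonneg t)
      linarith
    refine moments_eq_of_integral_one_add_rpow_eq ((hzm hw).inner measurable_const)
      ((hzm hw').inner measurable_const) (by positivity) (hb hw0) (hb hw0') hα (fun r hr => ?_) k
    rw [hint hw hw0 t r hr, hint hw' hw0' t r hr]
    exact h _ (hcoef t r hr)
  have hD' : MeasurableSet ((MeasurableEquiv.toLp 2 (B → ℝ)).symm ⁻¹' D) :=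
    (MeasurableEquiv.toLp 2 (B → ℝ)).symm.measurable hD
  have := congrArg (fun m => m ((MeasurableEquiv.toLp 2 (B → ℝ)).symm ⁻¹' D)) hmap
  rw [Measure.map_apply (hzm hw) hD', Measure.map_apply (hzm hw') hD',
    withDensity_apply _ (hzm hw hD'), withDensity_apply _ (hzm hw' hD')] at this
  exact this

/-! ### Lattice terms and the decomposition into cells -/

/-- Terms in `n` variables in the language of vector lattices. -/
inductive LatticeTerm (n : ℕ) : Type where
  | var (j : Fin n) : LatticeTerm n
  | zero : LatticeTerm n
  | add (σ τ : LatticeTerm n) : LatticeTerm n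
  | smul (c : ℝ) (τ : LatticeTerm n) : LatticeTerm n
  | sup (σ τ : LatticeTerm n) : LatticeTerm n
  | inf (σ τ : LatticeTerm n) : LatticeTerm n

namespace LatticeTerm

variable {n : ℕ}

/-- The value of a term at a tuple of elements of a vector lattice. -/
def eval {V : Type*} [AddCommGroup V] [Module ℝ V] [Lattice V] (v : Fin n → V) :
    LatticeTerm n → V
  | var j => v j
  | zero => 0
  | add σ τ => σ.eval v + τ.eval v
  | smul c τ => c • τ.eval v
  | sup σ τ => σ.eval v ⊔ τ.eval v
  | inf σ τ => σ.eval v ⊓ τ.eval v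

/-- Through this identity an isometric embedding leaves the norms of all terms unchanged, the only
property of the embeddings used in the main argument. -/
theorem map_eval {E F : Type*} [NormedAddCommGroup E] [NormedSpace ℝ E] [Lattice E]
    [NormedAddCommGroup F] [NormedSpace ℝ F] [Lattice F] {f : E →ₗᵢ[ℝ] F}
    (hf : IsLatticeEmbedding f) (v : Fin n → E) (τ : LatticeTerm n) :
    f (τ.eval v) = τ.eval fun j => f (v j) := by
  induction τ with
  | var j => rfl
  | zero => exact map_zero f
  | add σ τ h1 h2 => simp [eval, h1, h2]
  | smul c τ h => simp [eval, h]
  | sup σ τ h1 h2 => simp [eval, hf.map_sup, h1, h2]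
  | inf σ τ h1 h2 => simp [eval, hf.map_inf, h1, h2]

theorem coeFn_eval {α V : Type*} [MeasurableSpace α] {μ : Measure α} {p : ℝ≥0∞}
    [NormedAddCommGroup V] [NormedSpace ℝ V] [Lattice V] [HasSolidNorm V] [IsOrderedAddMonoid V]
    (h : Fin n → Lp V p μ) (τ : LatticeTerm n) :
    ∀ᵐ x ∂μ, τ.eval h x = τ.eval fun j => h j x := by
  induction τ with
  | var j => exact Filter.Eventually.of_forall fun x => rfl
  | zero =>
    filter_upwards [Lp.coeFn_zero V p μ] with x hx using hx
  | add σ τ h1 h2 =>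
    filter_upwards [Lp.coeFn_add (σ.eval h) (τ.eval h), h1, h2] with x hx h1 h2
    simp only [eval]; rw [hx, Pi.add_apply, h1, h2]
  | smul c τ h1 =>
    filter_upwards [Lp.coeFn_smul c (τ.eval h), h1] with x hx h1
    simp only [eval]; rw [hx, Pi.smul_apply, h1]
  | sup σ τ h1 h2 =>
    filter_upwards [Lp.coeFn_sup (σ.eval h) (τ.eval h), h1, h2] with x hx h1 h2
    simp only [eval]; rw [hx, Pi.sup_apply, h1, h2]
  | inf σ τ h1 h2 =>
    filter_upwards [Lp.coeFn_inf (σ.eval h) (τ.eval h), h1, h2] with x hx h1 h2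
    simp only [eval]; rw [hx, Pi.inf_apply, h1, h2]

theorem continuous_eval {V : Type*} [NormedAddCommGroup V] [NormedSpace ℝ V] [Lattice V]
    [HasSolidNorm V] [IsOrderedAddMonoid V] (τ : LatticeTerm n) :
    Continuous fun v : Fin n → V => τ.eval v := by
  induction τ with
  | var j => exact continuous_apply j
  | zero => exact continuous_const
  | add σ τ h1 h2 => exact h1.add h2
  | smul c τ h => exact h.const_smul c
  | sup σ τ h1 h2 => exact h1.sup h2
  | inf σ τ h1 h2 => exact h1.inf h2

/-- The sum of a finite list of terms. -/
def listSum (l : List (LatticeTerm n)) : LatticeTerm n := l.foldr add zero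

theorem eval_listSum {V : Type*} [AddCommGroup V] [Module ℝ V] [Lattice V] (v : Fin n → V)
    (l : List (LatticeTerm n)) : (listSum l).eval v = (l.map (eval v)).sum := by
  induction l with
  | nil => rfl
  | cons τ l ih =>
    rw [List.map_cons, List.sum_cons, ← ih]; rfl

/-- The sum of a finite family of terms. -/
noncomputable def sum {B : Type*} [Fintype B] (t : B → LatticeTerm n) : LatticeTerm n :=
  listSum (Finset.univ.toList.map t)

theorem eval_sum {V B : Type*} [AddCommGroup V] [Module ℝ V] [Lattice V] [Fintype B]
    (v : Fin n → V) (t : B → LatticeTerm n) : (sum t).eval v = ∑ b, (t b).eval v := by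
  rw [sum, eval_listSum, List.map_map, ← Finset.sum_map_toList]; rfl

/-- The term `∑ |v j|`. -/
noncomputable def unit (n : ℕ) : LatticeTerm n := sum fun j => sup (var j) (smul (-1) (var j))

theorem eval_unit (v : Fin n → ℝ) : (unit n).eval v = ∑ j, |v j| := by
  rw [unit, eval_sum]
  refine Finset.sum_congr rfl fun j _ => ?_
  simp [eval, abs]

theorem eval_unit_nonneg (v : Fin n → ℝ) : 0 ≤ (unit n).eval v := by
  rw [eval_unit]; exact Finset.sum_nonneg fun j _ => abs_nonneg _

theorem abs_le_eval_unit (v : Fin n → ℝ) (j : Fin n) : |v j| ≤ (unit n).eval v := by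
  rw [eval_unit]
  exact Finset.single_le_sum (f := fun j => |v j|) (fun j _ => abs_nonneg _) (Finset.mem_univ j)

theorem eval_unit_smul {c : ℝ} (hc : 0 ≤ c) (v : Fin n → ℝ) :
    ((unit n).eval fun j => c * v j) = c * (unit n).eval v := by
  simp only [eval_unit, abs_mul, abs_of_nonneg hc, Finset.mul_sum]

/-- The term `e ⊓ m (v j - a e)⁺`, where `e = ∑ |v j|`. As `m → ∞` it converges to `e` on
`{v j > a e}` and vanishes elsewhere. -/
noncomputable def step (m : ℕ) (a : ℝ) (j : Fin n) : LatticeTerm n :=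
  inf (unit n) (smul m (sup (add (var j) (smul (-a) (unit n))) zero))

theorem step_mem (m : ℕ) (a : ℝ) (j : Fin n) (v : Fin n → ℝ) :
    0 ≤ (step m a j).eval v ∧ (step m a j).eval v ≤ (unit n).eval v := by
  refine ⟨le_min (eval_unit_nonneg v) ?_, min_le_left _ _⟩
  exact mul_nonneg (Nat.cast_nonneg m) (le_max_right _ _)

open Filter Topology in
theorem tendsto_step (a : ℝ) (j : Fin n) (v : Fin n → ℝ) :
    Tendsto (fun m : ℕ => (step m a j).eval v) atTop
      (𝓝 (if a * (unit n).eval v < v j then (unit n).eval v else 0)) := by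
  have h : ∀ m : ℕ, (step m a j).eval v =
      min ((unit n).eval v) (m * max (v j + -a * (unit n).eval v) 0) := fun m => rfl
  simp only [h]
  split_ifs with hlt
  · have hpos : 0 < v j + -a * (unit n).eval v := by linarith
    refine tendsto_const_nhds.congr' ?_
    obtain ⟨M, hM⟩ := exists_nat_ge ((unit n).eval v / (v j + -a * (unit n).eval v))
    filter_upwards [eventually_ge_atTop M] with m hm
    rw [max_eq_left hpos.le, min_eq_left]
    rw [← div_le_iff₀ hpos]
    exact hM.trans (by exact_mod_cast hm)
  · have hle : v j + -a * (unit n).eval v ≤ 0 := by linarith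
    refine tendsto_const_nhds.congr fun m => ?_
    rw [max_eq_right hle, mul_zero, min_eq_right (eval_unit_nonneg v)]

/-- The lower end of the `k`-th interval of the subdivision of `(-1 - 1/N, 1]` into intervals of
length `1 / N`. -/
noncomputable def gridPoint (N k : ℕ) : ℝ := ((k : ℝ) - N - 1) / N

/-- The term approximating the part of `e` on which every `v j / e` lies in the `b j`-th interval
of the subdivision. -/
noncomputable def cell (N m : ℕ) (b : Fin n → Fin (2 * N + 1)) : LatticeTerm n :=
  ((List.finRange n).map fun j => add (step m (gridPoint N (b j)) j)
    (smul (-1) (step m (gridPoint N (b j + 1)) j))).foldr inf (unit n)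

theorem abs_cell_le (N m : ℕ) (b : Fin n → Fin (2 * N + 1)) (v : Fin n → ℝ) :
    |(cell N m b).eval v| ≤ (unit n).eval v := by
  have key : ∀ l : List (Fin n), |(((l.map fun j => add (step m (gridPoint N (b j)) j)
      (smul (-1) (step m (gridPoint N (b j + 1)) j))).foldr inf (unit n)).eval v)| ≤
      (unit n).eval v := by
    intro l
    induction l with
    | nil => exact (abs_of_nonneg (eval_unit_nonneg v)).le
    | cons j l ih =>
      simp only [List.map_cons, List.foldr_cons, eval]
      rw [abs_le] at ih ⊢
      have h1 := step_mem m (gridPoint N (b j)) j v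
      have h2 := step_mem m (gridPoint N (b j + 1)) j v
      refine ⟨le_min ?_ ih.1, (min_le_right _ _).trans ih.2⟩
      rw [smul_eq_mul]; linarith [h1.1, h2.2]
  exact key _

/-- The index of the cell containing a tuple. -/
noncomputable def cellIndex (N : ℕ) (v : Fin n → ℝ) (j : Fin n) : Fin (2 * N + 1) :=
  ⟨min ⌈N * (v j / (unit n).eval v) + N⌉₊ (2 * N), Nat.lt_succ_of_le (min_le_right _ _)⟩

/-- The part of `e = ∑ |v j|` in the cell `b`. -/
noncomputable def cellPart (N : ℕ) (b : Fin n → Fin (2 * N + 1)) (v : Fin n → ℝ) : ℝ :=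
  if cellIndex N v = b then (unit n).eval v else 0

/-- The intervals are open below and closed above, which fits both the ceiling and the strict
inequality in the limit of `step`. The additional interval below `-1` catches the ratio `-1`, and
ratios at most `1` make the truncation at `2 * N` inactive. -/
theorem cellIndex_eq_iff {N : ℕ} (hN : 0 < N) {v : Fin n → ℝ} (hv : 0 < (unit n).eval v)
    (j : Fin n) (k : Fin (2 * N + 1)) :
    cellIndex N v j = k ↔ gridPoint N k * (unit n).eval v < v j ∧
      ¬ gridPoint N (k + 1) * (unit n).eval v < v j := by
  have hN' : (0 : ℝ) < N := by exact_mod_cast hN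
  have habs := abs_le.1 (abs_le_eval_unit v j)
  set e := (unit n).eval v with he
  have hx1 : -1 ≤ v j / e := by rw [le_div_iff₀ hv]; linarith [habs.1]
  have hx2 : v j / e ≤ 1 := by rw [div_le_iff₀ hv]; linarith [habs.2]
  have h0 : 0 ≤ N * (v j / e) + N := by nlinarith
  have hle : ⌈N * (v j / e) + N⌉₊ ≤ 2 * N := by
    refine Nat.ceil_le.2 ?_
    push_cast; nlinarith
  have h1 : gridPoint N k * e < v j ↔ (k : ℝ) - 1 < N * (v j / e) + N := by
    rw [← lt_div_iff₀ hv, gridPoint, div_lt_iff₀ hN']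
    constructor <;> intro h <;> linarith
  have h2 : gridPoint N (k + 1) * e < v j ↔ (k : ℝ) < N * (v j / e) + N := by
    rw [← lt_div_iff₀ hv, gridPoint, div_lt_iff₀ hN']
    push_cast
    constructor <;> intro h <;> linarith
  rw [h1, h2, not_lt, Fin.ext_iff, cellIndex]
  simp only
  rw [min_eq_left hle]
  constructor
  · intro h
    rw [← h]
    exact ⟨by linarith [Nat.ceil_lt_add_one h0], Nat.le_ceil _⟩
  · rintro ⟨h3, h4⟩
    refine le_antisymm (Nat.ceil_le.2 h4) ?_
    by_contra hlt
    rw [not_le] at hlt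
    have h5 := Nat.le_ceil (N * (v j / e) + N)
    have h6 : ((⌈N * (v j / e) + N⌉₊ : ℕ) : ℝ) + 1 ≤ k := by exact_mod_cast hlt
    linarith

-- The difference of two consecutive steps tends to `e` on a slab of the `j`-th ratio and to `0` off
-- it; the infimum over `j` intersects the slabs.
open Filter Topology in
theorem tendsto_cell {N : ℕ} (hN : 0 < N) (b : Fin n → Fin (2 * N + 1)) (v : Fin n → ℝ) :
    Tendsto (fun m : ℕ => (cell N m b).eval v) atTop (𝓝 (cellPart N b v)) := by
  rcases (eval_unit_nonneg v).eq_or_lt with h0 | hpos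
  · have h1 : cellPart N b v = 0 := by simp [cellPart, ← h0]
    rw [h1]
    refine tendsto_const_nhds.congr fun m => ?_
    have := abs_cell_le N m b v
    rw [← h0] at this
    exact (abs_nonpos_iff.1 this).symm
  -- Monotonicity rules out the case in which the difference of steps would tend to `-e`.
  have hgrid : ∀ k : ℕ, gridPoint N k ≤ gridPoint N (k + 1) := fun k => by
    have hN' : (0 : ℝ) < N := by exact_mod_cast hN
    unfold gridPoint
    gcongr
    linarith
  have key : ∀ l : List (Fin n), Tendsto (fun m : ℕ =>
      ((l.map fun j => add (step m (gridPoint N (b j)) j)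
      (smul (-1) (step m (gridPoint N (b j + 1)) j))).foldr inf (unit n)).eval v) atTop
      (𝓝 (if ∀ j ∈ l, cellIndex N v j = b j then (unit n).eval v else 0)) := by
    intro l
    induction l with
    | nil => simp
    | cons j l ih =>
      have h1 := ((tendsto_step (gridPoint N (b j)) j v).add
        ((tendsto_step (gridPoint N (b j + 1)) j v).const_mul (-1))).min ih
      refine Tendsto.congr (fun m => ?_) (h1.trans (le_of_eq (congrArg 𝓝 ?_)))
      · simp only [List.map_cons, List.foldr_cons, eval]; rfl
      · have h2 := cellIndex_eq_iff hN hpos j (b j)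
        have h3 := mul_le_mul_of_nonneg_right (hgrid (b j)) hpos.le
        simp only [List.mem_cons, forall_eq_or_imp, h2]
        rw [ite_and]
        have ht : 0 ≤ (if ∀ j ∈ l, cellIndex N v j = b j then (unit n).eval v else 0) ∧
            (if ∀ j ∈ l, cellIndex N v j = b j then (unit n).eval v else 0) ≤ (unit n).eval v := by
          split_ifs
          exacts [⟨hpos.le, le_rfl⟩, ⟨le_rfl, hpos.le⟩]
        generalize (if ∀ j ∈ l, cellIndex N v j = b j then (unit n).eval v else 0) = t at ht
        by_cases ha : gridPoint N (b j) * (unit n).eval v < v j <;>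
        by_cases hb : gridPoint N (b j + 1) * (unit n).eval v < v j <;>
        simp [ha, hb, ht.1, ht.2]
        linarith
  refine (key (List.finRange n)).trans (le_of_eq (congrArg 𝓝 ?_))
  simp [cellPart, funext_iff]

theorem cellPart_nonneg (N : ℕ) (b : Fin n → Fin (2 * N + 1)) (v : Fin n → ℝ) :
    0 ≤ cellPart N b v := by
  unfold cellPart; split_ifs
  exacts [eval_unit_nonneg v, le_rfl]

theorem cellPart_smul (N : ℕ) (b : Fin n → Fin (2 * N + 1)) {c : ℝ} (hc : 0 < c)
    (v : Fin n → ℝ) : cellPart N b (fun j => c * v j) = c * cellPart N b v := by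
  have h : cellIndex N (fun j => c * v j) = cellIndex N v := by
    funext j
    simp only [cellIndex, eval_unit_smul hc.le, mul_div_mul_left _ _ hc.ne']
  simp only [cellPart, h, eval_unit_smul hc.le]
  split_ifs <;> simp

theorem sum_mul_cellPart (N : ℕ) (s : (Fin n → Fin (2 * N + 1)) → ℝ) (v : Fin n → ℝ) :
    ∑ b, s b * cellPart N b v = s (cellIndex N v) * (unit n).eval v := by
  simp [cellPart]

/-- At most one cell part is nonzero at a given tuple, so the power passes through the sum. -/
theorem sum_mul_cellPart_rpow (N : ℕ) {r : ℝ} (hr : 0 < r)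
    {s : (Fin n → Fin (2 * N + 1)) → ℝ} (hs : ∀ b, 0 ≤ s b) (v : Fin n → ℝ) :
    (∑ b, s b * cellPart N b v) ^ r = ∑ b, s b ^ r * cellPart N b v ^ r := by
  rw [sum_mul_cellPart, Real.mul_rpow (hs _) (eval_unit_nonneg v)]
  simp [cellPart, apply_ite (fun t : ℝ => t ^ r), Real.zero_rpow hr.ne']

/-- In each cell `v j` is replaced by the upper endpoint times `e`, an error of at most one interval
length. -/
theorem abs_sub_sum_cellPart_le {N : ℕ} (hN : 0 < N) (v : Fin n → ℝ) (j : Fin n) :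
    |v j - ∑ b, gridPoint N (b j + 1) * cellPart N b v| ≤ 1 / N * (unit n).eval v := by
  rw [sum_mul_cellPart N fun b => gridPoint N (b j + 1)]
  have hN' : (0 : ℝ) < N := by exact_mod_cast hN
  rcases (eval_unit_nonneg v).eq_or_lt with h0 | hpos
  · have := abs_le_eval_unit v j
    rw [← h0] at this ⊢
    simpa using this
  · obtain ⟨h1, h2⟩ := (cellIndex_eq_iff hN hpos j _).1 rfl
    have h3 : gridPoint N (cellIndex N v j) = gridPoint N (cellIndex N v j + 1) - 1 / N := by
      unfold gridPoint; push_cast; ring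
    rw [h3, sub_mul] at h1
    rw [abs_le]
    have := mul_pos (one_div_pos.2 hN') hpos
    constructor <;> linarith

theorem abs_gridPoint_le {N : ℕ} (hN : 0 < N) (k : Fin (2 * N + 1)) :
    |gridPoint N (k + 1)| ≤ 1 := by
  have hN' : (0 : ℝ) < N := by exact_mod_cast hN
  have hk : (k : ℝ) ≤ 2 * N := by exact_mod_cast Nat.lt_succ_iff.1 k.2
  have hk0 : (0 : ℝ) ≤ (k : ℕ) := Nat.cast_nonneg _
  rw [gridPoint, abs_le, le_div_iff₀ hN', div_le_iff₀ hN']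
  push_cast
  constructor <;> linarith

theorem measurable_eval (τ : LatticeTerm n) : Measurable fun v : Fin n → ℝ => τ.eval v :=
  τ.continuous_eval.measurable

theorem measurable_cellIndex (N : ℕ) : Measurable fun v : Fin n → ℝ => cellIndex N v := by
  refine measurable_pi_lambda _ fun j => ?_
  have h1 : Measurable fun k : ℕ =>
      (⟨min k (2 * N), Nat.lt_succ_of_le (min_le_right _ _)⟩ : Fin (2 * N + 1)) :=
    measurable_from_top
  exact h1.comp (Nat.measurable_ceil.comp ((((measurable_pi_apply j).div
    (measurable_eval _)).const_mul _).add_const _))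

theorem measurable_cellPart (N : ℕ) (b : Fin n → Fin (2 * N + 1)) : Measurable (cellPart N b) :=
  Measurable.ite (measurable_cellIndex N (measurableSet_singleton b)) (measurable_eval _)
    measurable_const

/-- A linear combination of the cell terms. -/
noncomputable def cellSum (N m : ℕ) (s : (Fin n → Fin (2 * N + 1)) → ℝ) : LatticeTerm n :=
  sum fun b => smul (s b) (cell N m b)

theorem abs_cellSum_le (N m : ℕ) {s : (Fin n → Fin (2 * N + 1)) → ℝ} (hs : ∀ b, 0 ≤ s b)
    (v : Fin n → ℝ) : |(cellSum N m s).eval v| ≤ (∑ b, s b) * (unit n).eval v := by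
  rw [cellSum, eval_sum, Finset.sum_mul]
  refine (Finset.abs_sum_le_sum_abs _ _).trans (Finset.sum_le_sum fun b _ => ?_)
  simp only [eval, smul_eq_mul]
  rw [abs_mul, abs_of_nonneg (hs b)]
  exact mul_le_mul_of_nonneg_left (abs_cell_le N m b v) (hs b)

open Filter Topology in
theorem tendsto_cellSum {N : ℕ} (hN : 0 < N) (s : (Fin n → Fin (2 * N + 1)) → ℝ)
    (v : Fin n → ℝ) : Tendsto (fun m : ℕ => (cellSum N m s).eval v) atTop
      (𝓝 (∑ b, s b * cellPart N b v)) := by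
  simp only [cellSum, eval_sum]
  exact tendsto_finsetSum _ fun b _ => (tendsto_cell hN b v).const_mul (s b)

end LatticeTerm

/-! ### Cell masses of tuples in `L_q` -/

theorem MeasureTheory.Lp.norm_rpow_eq_integral {α V : Type*} [MeasurableSpace α] {μ : Measure α}
    [NormedAddCommGroup V] {r : ℝ≥0∞} [Fact (1 ≤ r)] (hr : r ≠ ∞) (f : Lp V r μ) :
    ‖f‖ ^ r.toReal = ∫ x, ‖f x‖ ^ r.toReal ∂μ := by
  have hr0 : r ≠ 0 := (lt_of_lt_of_le zero_lt_one (Fact.out : 1 ≤ r)).ne'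
  have h0 : 0 ≤ ∫ x, ‖f x‖ ^ r.toReal ∂μ :=
    integral_nonneg fun x => Real.rpow_nonneg (norm_nonneg _) _
  rw [Lp.norm_def, (Lp.memLp f).eLpNorm_eq_integral_rpow_norm hr0 hr,
    ENNReal.toReal_ofReal (Real.rpow_nonneg h0 _),
    Real.rpow_inv_rpow h0 (ENNReal.toReal_pos hr0 hr).ne']

theorem MeasureTheory.Lp.integrable_norm_rpow {α V : Type*} [MeasurableSpace α] {μ : Measure α}
    [NormedAddCommGroup V] {r : ℝ≥0∞} [Fact (1 ≤ r)] (hr : r ≠ ∞) (f : Lp V r μ) :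
    Integrable (fun x => ‖f x‖ ^ r.toReal) μ :=
  (Lp.memLp f).integrable_norm_rpow
    (lt_of_lt_of_le zero_lt_one (Fact.out : 1 ≤ r)).ne' hr

set_option linter.unusedSectionVars false

namespace LatticeTerm

variable {n : ℕ} {α : Type*} [MeasurableSpace α] {μ : Measure α} {q : ℝ≥0∞} [Fact (1 ≤ q)]

theorem toReal_exponent_pos (hq : q ≠ ∞) : 0 < q.toReal :=
  ENNReal.toReal_pos (lt_of_lt_of_le zero_lt_one (Fact.out : 1 ≤ q)).ne' hq

theorem measurable_pointwise (v : Fin n → Lp ℝ q μ) : Measurable fun y (j : Fin n) => v j y :=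
  measurable_pi_lambda _ fun j => (Lp.stronglyMeasurable (v j)).measurable

/-- The `q`-th power of the `L_q`-norm of the part of `∑ |v j|` in the cell `b`. -/
noncomputable def cellMass (N : ℕ) (b : Fin n → Fin (2 * N + 1)) (v : Fin n → Lp ℝ q μ) : ℝ :=
  ∫ y, cellPart N b (fun j => v j y) ^ q.toReal ∂μ

theorem cellMass_nonneg (N : ℕ) (b : Fin n → Fin (2 * N + 1)) (v : Fin n → Lp ℝ q μ) :
    0 ≤ cellMass N b v :=
  integral_nonneg fun _ => Real.rpow_nonneg (cellPart_nonneg N b _) _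

theorem memLp_eval_pointwise (τ : LatticeTerm n) (v : Fin n → Lp ℝ q μ) :
    MemLp (fun y => τ.eval fun j => v j y) q μ :=
  (memLp_congr_ae (coeFn_eval v τ)).1 (Lp.memLp _)

theorem memLp_cellPart (N : ℕ) (b : Fin n → Fin (2 * N + 1)) (v : Fin n → Lp ℝ q μ) :
    MemLp (fun y => cellPart N b fun j => v j y) q μ := by
  refine MemLp.mono' (memLp_eval_pointwise (unit n) v)
    ((measurable_cellPart N b).comp (measurable_pointwise v)).aestronglyMeasurable
    (Filter.Eventually.of_forall fun y => ?_)
  rw [Real.norm_of_nonneg (cellPart_nonneg N b _), cellPart]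
  split_ifs
  exacts [le_rfl, eval_unit_nonneg _]

theorem integrable_cellPart_rpow (hq : q ≠ ∞) (N : ℕ) (b : Fin n → Fin (2 * N + 1))
    (v : Fin n → Lp ℝ q μ) : Integrable (fun y => cellPart N b (fun j => v j y) ^ q.toReal) μ := by
  have := (memLp_cellPart N b v).integrable_norm_rpow
    (lt_of_lt_of_le zero_lt_one (Fact.out : 1 ≤ q)).ne' hq
  simpa only [Real.norm_of_nonneg (cellPart_nonneg N b _)] using this

theorem norm_eval_rpow (hq : q ≠ ∞) (τ : LatticeTerm n) (v : Fin n → Lp ℝ q μ) :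
    ‖τ.eval v‖ ^ q.toReal = ∫ y, |τ.eval fun j => v j y| ^ q.toReal ∂μ := by
  rw [Lp.norm_rpow_eq_integral hq]
  refine integral_congr_ae ?_
  filter_upwards [coeFn_eval v τ] with y hy
  rw [hy, Real.norm_eq_abs]

theorem integrable_eval_rpow (hq : q ≠ ∞) (τ : LatticeTerm n) (v : Fin n → Lp ℝ q μ) :
    Integrable (fun y => |τ.eval fun j => v j y| ^ q.toReal) μ :=
  (memLp_eval_pointwise τ v).integrable_norm_rpow
    (lt_of_lt_of_le zero_lt_one (Fact.out : 1 ≤ q)).ne' hq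

theorem norm_cellSum_le (N m : ℕ) {s : (Fin n → Fin (2 * N + 1)) → ℝ} (hs : ∀ b, 0 ≤ s b)
    (v : Fin n → Lp ℝ q μ) :
    ‖(cellSum N m s).eval v‖ ≤ (∑ b, s b) * ‖(unit n).eval v‖ := by
  refine Lp.norm_le_mul_norm_of_ae_le_mul ?_
  filter_upwards [coeFn_eval v (cellSum N m s), coeFn_eval v (unit n)] with y h1 h2
  rw [h1, h2, Real.norm_eq_abs, Real.norm_of_nonneg (eval_unit_nonneg _)]
  exact abs_cellSum_le N m hs _

-- Disjointness of the cells makes the limit linear in the powers `s b ^ q`; dominated convergence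
-- applies with a multiple of `e` as majorant.
open Filter Topology in
theorem tendsto_norm_cellSum (hq : q ≠ ∞) {N : ℕ} (hN : 0 < N)
    {s : (Fin n → Fin (2 * N + 1)) → ℝ} (hs : ∀ b, 0 ≤ s b) (v : Fin n → Lp ℝ q μ) :
    Tendsto (fun m : ℕ => ‖(cellSum N m s).eval v‖ ^ q.toReal) atTop
      (𝓝 (∑ b, s b ^ q.toReal * cellMass N b v)) := by
  have hq0 := toReal_exponent_pos hq
  have h1 : ∑ b, s b ^ q.toReal * cellMass N b v =
      ∫ y, |∑ b, s b * cellPart N b fun j => v j y| ^ q.toReal ∂μ := by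
    simp only [cellMass, ← integral_const_mul]
    rw [← integral_finsetSum _ fun b _ => (integrable_cellPart_rpow hq N b v).const_mul _]
    refine integral_congr_ae (Eventually.of_forall fun y => ?_)
    simp only
    rw [abs_of_nonneg (Finset.sum_nonneg fun b _ => mul_nonneg (hs b) (cellPart_nonneg N b _)),
      sum_mul_cellPart_rpow N hq0 hs]
  simp only [norm_eval_rpow hq]
  rw [h1]
  refine tendsto_integral_of_dominated_convergence
    (fun y => (∑ b, s b) ^ q.toReal * |(unit n).eval fun j => v j y| ^ q.toReal)
    (fun m => (integrable_eval_rpow hq (cellSum N m s) v).aestronglyMeasurable)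
    ((integrable_eval_rpow hq (unit n) v).const_mul _)
    (fun m => Eventually.of_forall fun y => ?_) (Eventually.of_forall fun y => ?_)
  · rw [Real.norm_of_nonneg (Real.rpow_nonneg (abs_nonneg _) _),
      ← Real.mul_rpow (Finset.sum_nonneg fun b _ => hs b) (abs_nonneg _),
      abs_of_nonneg (eval_unit_nonneg _)]
    exact Real.rpow_le_rpow (abs_nonneg _) (abs_cellSum_le N m hs _) hq0.le
  · exact ((tendsto_cellSum hN s _).abs).rpow_const (Or.inr hq0.le)

theorem sum_cellMass (hq : q ≠ ∞) (N : ℕ) (v : Fin n → Lp ℝ q μ) :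
    ∑ b, cellMass N b v = ‖(unit n).eval v‖ ^ q.toReal := by
  rw [norm_eval_rpow hq]
  simp only [cellMass]
  rw [← integral_finsetSum _ fun b _ => integrable_cellPart_rpow hq N b v]
  refine integral_congr_ae (Filter.Eventually.of_forall fun y => ?_)
  have h := sum_mul_cellPart_rpow N (toReal_exponent_pos hq) (s := fun _ => 1)
    (fun _ => zero_le_one) fun j => v j y
  rw [sum_mul_cellPart N fun _ => 1] at h
  simp only [one_mul, Real.one_rpow] at h
  simp only
  rw [← h, abs_of_nonneg (eval_unit_nonneg _)]

theorem cellMass_smul (N : ℕ) (b : Fin n → Fin (2 * N + 1)) {c : ℝ} (hc : 0 < c)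
    (v : Fin n → Lp ℝ q μ) : cellMass N b (c • v) = c ^ q.toReal * cellMass N b v := by
  rw [cellMass, cellMass, ← integral_const_mul]
  refine integral_congr_ae ?_
  have h : ∀ᵐ y ∂μ, ∀ j, (c • v) j y = c * v j y := ae_all_iff.2 fun j => by
    filter_upwards [Lp.coeFn_smul c (v j)] with y hy
    rw [Pi.smul_apply, hy]; rfl
  filter_upwards [h] with y hy
  simp only [hy]
  rw [cellPart_smul N b hc, Real.mul_rpow hc.le (cellPart_nonneg N b _)]

theorem norm_eval_unit_smul (hq : q ≠ ∞) {c : ℝ} (hc : 0 < c) (v : Fin n → Lp ℝ q μ) :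
    ‖(unit n).eval (c • v)‖ = c * ‖(unit n).eval v‖ := by
  have hq0 := toReal_exponent_pos hq
  have h := sum_cellMass hq 1 (c • v)
  simp only [cellMass_smul 1 _ hc] at h
  rw [← Finset.mul_sum, sum_cellMass hq, ← Real.mul_rpow hc.le (norm_nonneg _)] at h
  exact (Real.rpow_left_inj (norm_nonneg _) (mul_nonneg hc.le (norm_nonneg _)) hq0.ne').1 h.symm

theorem norm_le_norm_eval_unit (v : Fin n → Lp ℝ q μ) (j : Fin n) :
    ‖v j‖ ≤ ‖(unit n).eval v‖ := by
  refine Lp.norm_le_norm_of_ae_le ?_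
  filter_upwards [coeFn_eval v (unit n)] with y h
  rw [h, Real.norm_eq_abs, Real.norm_of_nonneg (eval_unit_nonneg _)]
  exact abs_le_eval_unit (fun j => v j y) j

/-- The mass of one cell is a pointwise limit of powers of norms of lattice terms, each continuous
on tuples in `L_q`. -/
theorem measurable_cellMass [MeasurableSpace (Lp ℝ q μ)] [BorelSpace (Lp ℝ q μ)]
    [SecondCountableTopology (Lp ℝ q μ)] (hq : q ≠ ∞) {N : ℕ} (hN : 0 < N)
    (b : Fin n → Fin (2 * N + 1)) : Measurable (cellMass N b : (Fin n → Lp ℝ q μ) → ℝ) := by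
  have hq0 := toReal_exponent_pos hq
  refine measurable_of_tendsto_metrizable
    (f := fun m v => ‖(cellSum N m (Pi.single b 1)).eval v‖ ^ q.toReal) (fun m => ?_) ?_
  · exact ((continuous_eval _).norm.measurable).pow_const _
  · rw [tendsto_pi_nhds]
    intro v
    have h := tendsto_norm_cellSum hq hN (s := Pi.single b 1) (fun b' => ?_) v
    · convert h using 2
      rw [Finset.sum_eq_single b]
      · simp
      · intro b' _ hb'
        rw [Pi.single_eq_of_ne hb', Real.zero_rpow hq0.ne', zero_mul]
      · simp
    · by_cases hb : b' = b
      · subst hb; simp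
      · simp [Pi.single_eq_of_ne hb]

end LatticeTerm

/-! ### Approximate conjugacy of tuples in `L_q` -/

namespace LatticeTerm

variable {n : ℕ} {q : ℝ≥0∞} [Fact (1 ≤ q)]

theorem eLpNorm_cellPart {α : Type*} [MeasurableSpace α] {μ : Measure α} (hq : q ≠ ∞) (N : ℕ)
    (b : Fin n → Fin (2 * N + 1)) (v : Fin n → Lp ℝ q μ) :
    (eLpNorm (fun y => cellPart N b fun j => v j y) q μ).toReal =
      cellMass N b v ^ (q.toReal)⁻¹ := by
  rw [(memLp_cellPart N b v).eLpNorm_eq_integral_rpow_norm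
    (lt_of_lt_of_le zero_lt_one (Fact.out : 1 ≤ q)).ne' hq, ENNReal.toReal_ofReal]
  · simp only [Real.norm_of_nonneg (cellPart_nonneg N b _), cellMass]
  · exact Real.rpow_nonneg (integral_nonneg fun y => Real.rpow_nonneg (norm_nonneg _) _) _

theorem norm_sub_sum_cellPart_le {α : Type*} [MeasurableSpace α] {μ : Measure α} {N : ℕ}
    (hN : 0 < N) (v : Fin n → Lp ℝ q μ) (j : Fin n) :
    ‖v j - ∑ b, gridPoint N (b j + 1) • (memLp_cellPart N b v).toLp‖ ≤
      1 / N * ‖(unit n).eval v‖ := by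
  refine Lp.norm_le_mul_norm_of_ae_le_mul ?_
  have h1 : ∀ᵐ y ∂μ, ∀ b : Fin n → Fin (2 * N + 1),
      (gridPoint N (b j + 1) • (memLp_cellPart N b v).toLp) y =
        gridPoint N (b j + 1) * cellPart N b fun j => v j y := ae_all_iff.2 fun b => by
    filter_upwards [Lp.coeFn_smul (gridPoint N (b j + 1)) (memLp_cellPart N b v).toLp,
      (memLp_cellPart N b v).coeFn_toLp] with y h1 h2
    rw [h1, Pi.smul_apply, h2, smul_eq_mul]
  filter_upwards [coeFn_eval v (unit n), Lp.coeFn_sub (v j)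
    (∑ b, gridPoint N (b j + 1) • (memLp_cellPart N b v).toLp), h1,
    Lp.coeFn_finsetSum Finset.univ fun b : Fin n → Fin (2 * N + 1) =>
      gridPoint N (b j + 1) • (memLp_cellPart N b v).toLp] with y h2 h3 h4 h5
  rw [h3, Pi.sub_apply, h5, h2, Real.norm_of_nonneg (eval_unit_nonneg _), Real.norm_eq_abs,
    Finset.sum_apply]
  simp only [h4]
  exact abs_sub_sum_cellPart_le hN (fun j => v j y) j

/-- Two tuples in `L_q` whose cells have nearly the same norms are nearly exchanged by a lattice
automorphism of `L_q`. -/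
theorem exists_automorphism_of_cellMass (hq : q ≠ ∞) {N : ℕ} (hN : 0 < N)
    (v v' : Fin n → Lp ℝ q (volume : Measure unitInterval)) {δ : ℝ} (hδ : 0 < δ) :
    ∃ R : Lp ℝ q (volume : Measure unitInterval) ≃ₗᵢ[ℝ] Lp ℝ q (volume : Measure unitInterval),
      IsLatticeAutomorphism R ∧ ∀ j, ‖R (v j) - v' j‖ ≤
        1 / N * ‖(unit n).eval v‖ + 1 / N * ‖(unit n).eval v'‖ +
        ∑ b, (|cellMass N b v ^ (q.toReal)⁻¹ - cellMass N b v' ^ (q.toReal)⁻¹| + δ) := by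
  have hu : ∀ v : Fin n → Lp ℝ q (volume : Measure unitInterval),
      Measurable fun y => (unit n).eval fun j => v j y := fun v =>
    (measurable_eval _).comp (measurable_pointwise v)
  have hc : ∀ v : Fin n → Lp ℝ q (volume : Measure unitInterval),
      Measurable fun y => cellIndex N fun j => v j y := fun v =>
    (measurable_cellIndex N).comp (measurable_pointwise v)
  have hind : ∀ (v : Fin n → Lp ℝ q (volume : Measure unitInterval)) b,
      ((fun y => cellIndex N fun j => v j y) ⁻¹' {b}).indicator
        (fun y => (unit n).eval fun j => v j y) = fun y => cellPart N b fun j => v j y := by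
    intro v b
    funext y
    simp [Set.indicator, cellPart]
  -- With the cell index as colour, the restriction of `e` to a colour is the corresponding cell
  -- part, so one transport handles all cells together.
  obtain ⟨σ, w, hT, happ⟩ := exists_isTransport_approx q hq (hu v) (hu v')
    (fun y => eval_unit_nonneg _) (fun y => eval_unit_nonneg _) (memLp_eval_pointwise _ v)
    (memLp_eval_pointwise _ v') (hc v) (hc v') hδ
  obtain ⟨R, hR, hRf⟩ := hT.exists_automorphism ℝ
  refine ⟨R, hR, fun j => ?_⟩
  let V := fun (v : Fin n → Lp ℝ q (volume : Measure unitInterval)) b =>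
    (memLp_cellPart N b v).toLp
  have hV : ∀ b, ‖R (V v b) - V v' b‖ ≤
      |cellMass N b v ^ (q.toReal)⁻¹ - cellMass N b v' ^ (q.toReal)⁻¹| + δ := by
    intro b
    have h := happ b
    rw [hind, hind, eLpNorm_cellPart hq, eLpNorm_cellPart hq] at h
    rw [Lp.norm_def]
    refine ENNReal.toReal_le_of_le_ofReal (by positivity) (le_trans (le_of_eq ?_) h)
    refine eLpNorm_congr_ae ?_
    filter_upwards [Lp.coeFn_sub (R (V v b)) (V v' b), hRf (V v b),
      hT.quasiMeasurePreserving.ae (memLp_cellPart N b v).coeFn_toLp,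
      (memLp_cellPart N b v').coeFn_toLp] with y h1 h2 h3 h4
    rw [h1, Pi.sub_apply, h2, h3, h4, smul_eq_mul]
  have hsplit : R (v j) - v' j = R (v j - ∑ b, gridPoint N (b j + 1) • V v b) -
      (v' j - ∑ b, gridPoint N (b j + 1) • V v' b) +
      ∑ b, gridPoint N (b j + 1) • (R (V v b) - V v' b) := by
    simp only [map_sub, map_sum, map_smul, smul_sub, Finset.sum_sub_distrib]
    abel
  rw [hsplit]
  refine (norm_add_le _ _).trans (add_le_add ((norm_sub_le _ _).trans (add_le_add ?_ ?_)) ?_)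
  · rw [R.norm_map]; exact norm_sub_sum_cellPart_le hN v j
  · exact norm_sub_sum_cellPart_le hN v' j
  · refine (norm_sum_le _ _).trans (Finset.sum_le_sum fun b _ => ?_)
    rw [norm_smul, Real.norm_eq_abs]
    refine le_trans ?_ (hV b)
    exact mul_le_of_le_one_left (norm_nonneg _) (abs_gridPoint_le hN _)

/-- The relative masses of the cells of a tuple. -/
noncomputable def profile (N : ℕ) (v : Fin n → Lp ℝ q (volume : Measure unitInterval))
    (b : Fin n → Fin (2 * N + 1)) : ℝ :=
  cellMass N b v / ∑ b, cellMass N b v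

/-- Discretisation of the `r`-th roots of a vector with coordinates in `[0, 1]`. -/
noncomputable def discretize {B : Type*} (M : ℕ) (r : ℝ) (z : B → ℝ) (b : B) : Fin (M + 1) :=
  ⟨min ⌊M * z b ^ r⁻¹⌋₊ M, Nat.lt_succ_of_le (min_le_right _ _)⟩

theorem measurable_discretize {B : Type*} (M : ℕ) (r : ℝ) :
    Measurable (discretize M r : (B → ℝ) → B → Fin (M + 1)) := by
  refine measurable_pi_lambda _ fun b => ?_
  have h1 : Measurable fun k : ℕ =>
      (⟨min k M, Nat.lt_succ_of_le (min_le_right _ _)⟩ : Fin (M + 1)) := measurable_from_top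
  exact h1.comp (Nat.measurable_floor.comp (((measurable_pi_apply b).pow_const _).const_mul _))

/-- Roots are discretised because the norm, not the mass, of a cell enters the error estimate. On
`[0, 1]` the truncation at `M` is inactive. -/
theorem abs_sub_le_of_discretize_eq {B : Type*} {M : ℕ} (hM : 0 < M) {r : ℝ} (hr : 0 < r)
    {z z' : B → ℝ} {b : B} (hz : 0 ≤ z b ∧ z b ≤ 1) (hz' : 0 ≤ z' b ∧ z' b ≤ 1)
    (h : discretize M r z b = discretize M r z' b) :
    |z b ^ r⁻¹ - z' b ^ r⁻¹| ≤ 1 / M := by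
  have hM' : (0 : ℝ) < M := by exact_mod_cast hM
  have key : ∀ {t : ℝ}, 0 ≤ t ∧ t ≤ 1 → min ⌊M * t ^ r⁻¹⌋₊ M = ⌊M * t ^ r⁻¹⌋₊ ∧
      0 ≤ M * t ^ r⁻¹ := fun {t} ht => by
    have h0 : 0 ≤ t ^ r⁻¹ := Real.rpow_nonneg ht.1 _
    refine ⟨min_eq_left (Nat.floor_le_of_le ?_), by positivity⟩
    exact mul_le_of_le_one_right hM'.le (Real.rpow_le_one ht.1 ht.2 (inv_pos.2 hr).le)
  have h' := congrArg Fin.val h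
  simp only [discretize] at h'
  rw [(key hz).1, (key hz').1] at h'
  have h1 := Nat.floor_le (key hz).2
  have h2 := Nat.lt_floor_add_one (M * z b ^ r⁻¹)
  have h3 := Nat.floor_le (key hz').2
  have h4 := Nat.lt_floor_add_one (M * z' b ^ r⁻¹)
  rw [h'] at h1 h2
  rw [le_div_iff₀ hM', ← abs_of_pos hM', ← abs_mul, abs_le]
  constructor <;> linarith

theorem cellMass_rpow_eq (hq : q ≠ ∞) (N : ℕ) (b : Fin n → Fin (2 * N + 1))
    {v : Fin n → Lp ℝ q (volume : Measure unitInterval)} (hv : 0 < ‖(unit n).eval v‖) :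
    cellMass N b v ^ (q.toReal)⁻¹ = ‖(unit n).eval v‖ * profile N v b ^ (q.toReal)⁻¹ := by
  have hq0 := toReal_exponent_pos hq
  rw [profile, sum_cellMass hq, Real.div_rpow (cellMass_nonneg N b v) (by positivity),
    Real.rpow_rpow_inv hv.le hq0.ne', mul_div_cancel₀ _ hv.ne']

theorem profile_mem (N : ℕ) (b : Fin n → Fin (2 * N + 1))
    (v : Fin n → Lp ℝ q (volume : Measure unitInterval)) : 0 ≤ profile N v b ∧ profile N v b ≤ 1 := by
  have h : 0 ≤ ∑ b, cellMass N b v := Finset.sum_nonneg fun b _ => cellMass_nonneg N b v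
  exact ⟨div_nonneg (cellMass_nonneg N b v) h, div_le_one_of_le₀
    (Finset.single_le_sum (fun b _ => cellMass_nonneg N b v) (Finset.mem_univ b)) h⟩

theorem profile_smul (N : ℕ) {c : ℝ} (hc : 0 < c)
    (v : Fin n → Lp ℝ q (volume : Measure unitInterval)) : profile N (c • v) = profile N v := by
  funext b
  have : c ^ q.toReal ≠ 0 := (Real.rpow_pos_of_pos hc _).ne'
  simp only [profile, cellMass_smul N _ hc, ← Finset.mul_sum, mul_div_mul_left _ _ this]

variable (n q) in
/-- Tuples in `L_q` with the same discretised profile are, after normalisation, nearly exchanged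
by a lattice automorphism. -/
theorem exists_automorphism_of_discretize_eq (hq : q ≠ ∞) {ε : ℝ} (hε : 0 < ε) :
    ∃ N M : ℕ, 0 < N ∧ 0 < M ∧ ∀ v c : Fin n → Lp ℝ q (volume : Measure unitInterval),
      0 < ‖(unit n).eval v‖ → ‖(unit n).eval c‖ = 1 →
      discretize M q.toReal (profile N v) = discretize M q.toReal (profile N c) →
      ∃ R : Lp ℝ q (volume : Measure unitInterval) ≃ₗᵢ[ℝ] Lp ℝ q (volume : Measure unitInterval),
        IsLatticeAutomorphism R ∧
        ∀ j, ‖R (v j) - ‖(unit n).eval v‖ • c j‖ < ε * ‖(unit n).eval v‖ := by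
  have hq0 := toReal_exponent_pos hq
  -- Relative to `‖e‖`, the two cell approximations cost `ε / 8` each and the `K` cells together at
  -- most `ε / 4`, which leaves room for strict inequality.
  obtain ⟨N', hN'⟩ := exists_nat_one_div_lt (show (0 : ℝ) < ε / 8 by positivity)
  let K : ℝ := Fintype.card (Fin n → Fin (2 * (N' + 1) + 1))
  have hK : 0 ≤ K := Nat.cast_nonneg _
  obtain ⟨M', hM'⟩ := exists_nat_one_div_lt (show (0 : ℝ) < ε / (8 * (K + 1)) by positivity)
  refine ⟨N' + 1, M' + 1, N'.succ_pos, M'.succ_pos, fun v c hv hc hvc => ?_⟩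
  set t := ‖(unit n).eval v‖ with ht
  have htc : ‖(unit n).eval (t • c)‖ = t := by rw [norm_eval_unit_smul hq hv, hc, mul_one]
  obtain ⟨R, hR, hRv⟩ := exists_automorphism_of_cellMass hq N'.succ_pos v (t • c)
    (show 0 < t * (ε / (8 * (K + 1))) by positivity)
  refine ⟨R, hR, fun j => (hRv j).trans_lt ?_⟩
  have hsum : ∑ b, (|cellMass (N' + 1) b v ^ (q.toReal)⁻¹ -
      cellMass (N' + 1) b (t • c) ^ (q.toReal)⁻¹| + t * (ε / (8 * (K + 1)))) ≤
      ∑ _b : Fin n → Fin (2 * (N' + 1) + 1), (t * (ε / (8 * (K + 1))) + t * (ε / (8 * (K + 1)))) := by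
    refine Finset.sum_le_sum fun b _ => add_le_add ?_ le_rfl
    rw [cellMass_rpow_eq hq _ b hv, cellMass_rpow_eq hq _ b (by rw [htc]; exact hv), htc,
      profile_smul _ hv, ← ht, ← mul_sub, abs_mul, abs_of_pos hv]
    refine mul_le_mul_of_nonneg_left ?_ hv.le
    have h1 := abs_sub_le_of_discretize_eq M'.succ_pos hq0 (profile_mem _ b v)
      (profile_mem _ b c) (congrFun hvc b)
    push_cast at h1
    exact h1.trans hM'.le
  rw [htc, ← ht]
  have h2 : ∑ _b : Fin n → Fin (2 * (N' + 1) + 1),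
      (t * (ε / (8 * (K + 1))) + t * (ε / (8 * (K + 1)))) ≤ t * (ε / 4) := by
    rw [Finset.sum_const, nsmul_eq_mul]
    change K * _ ≤ _
    have h3 : K * (ε / (8 * (K + 1))) ≤ ε / 8 := by
      rw [mul_div_assoc', div_le_div_iff₀ (by positivity) (by positivity)]
      nlinarith
    nlinarith
  have h4 : 1 / ((N' + 1 : ℕ) : ℝ) * t ≤ ε / 8 * t := by
    push_cast
    exact mul_le_mul_of_nonneg_right hN'.le hv.le
  nlinarith [hsum.trans h2, mul_pos hε hv]

end LatticeTerm

/-! ### Reference tuples and fibrewise alignment -/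

namespace LatticeTerm

variable {n : ℕ} {q : ℝ≥0∞} [Fact (1 ≤ q)]

/-- The discretised profile of a tuple. -/
noncomputable def color (N M : ℕ) (v : Fin n → Lp ℝ q (volume : Measure unitInterval)) :
    (Fin n → Fin (2 * N + 1)) → Fin (M + 1) :=
  discretize M q.toReal (profile N v)

variable (n q) in
/-- Up to countably many lattice automorphisms of `L_q`, a tuple is nearly determined by its norm
and its colour. -/
theorem exists_reference (hq : q ≠ ∞) {ε : ℝ} (hε : 0 < ε) :
    ∃ N M : ℕ, 0 < N ∧
      ∃ (c : ((Fin n → Fin (2 * N + 1)) → Fin (M + 1)) → Fin n →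
          Lp ℝ q (volume : Measure unitInterval))
        (R : ℕ → Lp ℝ q (volume : Measure unitInterval) ≃ₗᵢ[ℝ]
          Lp ℝ q (volume : Measure unitInterval)),
      (∀ κ j, ‖c κ j‖ ≤ 1) ∧ (∀ k, IsLatticeAutomorphism (R k)) ∧
      ∀ v : Fin n → Lp ℝ q (volume : Measure unitInterval), 0 < ‖(unit n).eval v‖ →
        ∃ k, ∀ j, ‖R k (v j) - ‖(unit n).eval v‖ • c (color N M v) j‖ <
          ε * ‖(unit n).eval v‖ := by
  have : Fact (q ≠ ∞) := ⟨hq⟩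
  obtain ⟨N, M, hN, -, H⟩ := exists_automorphism_of_discretize_eq n q hq hε
  have href : ∀ κ : (Fin n → Fin (2 * N + 1)) → Fin (M + 1),
      ∃ c : Fin n → Lp ℝ q (volume : Measure unitInterval), (∀ j, ‖c j‖ ≤ 1) ∧
        ∀ v : Fin n → Lp ℝ q (volume : Measure unitInterval), 0 < ‖(unit n).eval v‖ →
          color N M v = κ → ‖(unit n).eval c‖ = 1 ∧ color N M c = κ := by
    intro κ
    -- Any normalised tuple of colour `κ` serves as reference, since profiles are scale invariant; a
    -- colour that does not occur gets `0`.
    by_cases h : ∃ v : Fin n → Lp ℝ q (volume : Measure unitInterval),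
        0 < ‖(unit n).eval v‖ ∧ color N M v = κ
    · obtain ⟨v, hv, hvκ⟩ := h
      have h1 : ‖(unit n).eval (‖(unit n).eval v‖⁻¹ • v)‖ = 1 := by
        rw [norm_eval_unit_smul hq (inv_pos.2 hv), inv_mul_cancel₀ hv.ne']
      refine ⟨‖(unit n).eval v‖⁻¹ • v, fun j => ?_, fun _ _ _ => ⟨h1, ?_⟩⟩
      · rw [← h1]; exact norm_le_norm_eval_unit _ j
      · rw [← hvκ, color, color, profile_smul N (inv_pos.2 hv)]
    · exact ⟨0, fun j => by simp, fun v hv hvκ => absurd ⟨v, hv, hvκ⟩ h⟩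
  choose c hc1 hc using href
  let A := {R : Lp ℝ q (volume : Measure unitInterval) ≃ₗᵢ[ℝ]
    Lp ℝ q (volume : Measure unitInterval) // IsLatticeAutomorphism R}
  let U := fun (κ : (Fin n → Fin (2 * N + 1)) → Fin (M + 1)) (R : A) =>
    {v : Fin n → Lp ℝ q (volume : Measure unitInterval) |
      ∀ j, ‖R.1 (v j) - ‖(unit n).eval v‖ • c κ j‖ < ε * ‖(unit n).eval v‖}
  have hU : ∀ κ R, IsOpen (U κ R) := fun κ R => by
    have h1 : U κ R = ⋂ j, {v | ‖R.1 (v j) - ‖(unit n).eval v‖ • c κ j‖ <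
        ε * ‖(unit n).eval v‖} := by
      ext v; simp [U]
    rw [h1]
    refine isOpen_iInter_of_finite fun j => isOpen_lt ?_ ?_
    · exact ((R.1.continuous.comp (continuous_apply j)).sub
        ((continuous_eval _).norm.smul continuous_const)).norm
    · exact (continuous_eval _).norm.const_mul ε
  -- Lindelöf property: `L_q` is separable for `q ≠ ∞`, so countably many automorphisms already
  -- cover all tuples that can be moved near the reference.
  choose T hT hTU using fun κ => TopologicalSpace.isOpen_iUnion_countable (U κ) (hU κ)
  let idA : A := ⟨LinearIsometryEquiv.refl ℝ _, ⟨fun _ _ => rfl, fun _ _ => rfl⟩⟩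
  have hcount : (insert idA (⋃ κ, T κ)).Countable :=
    (Set.countable_iUnion hT).insert _
  obtain ⟨R, hR⟩ := hcount.exists_eq_range ⟨idA, Set.mem_insert _ _⟩
  refine ⟨N, M, hN, c, fun k => (R k).1, hc1, fun k => (R k).2, fun v hv => ?_⟩
  obtain ⟨h1, h2⟩ := hc (color N M v) v hv rfl
  obtain ⟨S, hS, hSv⟩ := H v (c (color N M v)) hv h1 h2.symm
  have hmem : v ∈ ⋃ R, U (color N M v) R := Set.mem_iUnion.2 ⟨⟨S, hS⟩, hSv⟩
  rw [← hTU] at hmem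
  obtain ⟨Q, hQ, hvQ⟩ := Set.mem_iUnion₂.1 hmem
  have hQ' : Q ∈ Set.range R := hR ▸ Set.mem_insert_of_mem _ (Set.mem_iUnion.2 ⟨_, hQ⟩)
  obtain ⟨k, rfl⟩ := hQ'
  exact ⟨k, hvQ⟩

theorem measurable_color [MeasurableSpace (Lp ℝ q (volume : Measure unitInterval))]
    [BorelSpace (Lp ℝ q (volume : Measure unitInterval))]
    [SecondCountableTopology (Lp ℝ q (volume : Measure unitInterval))] (hq : q ≠ ∞) {N : ℕ}
    (hN : 0 < N) (M : ℕ) : Measurable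
      (color N M : (Fin n → Lp ℝ q (volume : Measure unitInterval)) → _) := by
  refine (measurable_discretize M q.toReal).comp (measurable_pi_lambda _ fun b => ?_)
  exact (measurable_cellMass hq hN b).div
    (Finset.measurable_sum _ fun b _ => measurable_cellMass hq hN b)

variable {p : ℝ≥0∞} [Fact (1 ≤ p)]

/-- A tuple in `L_p(L_q)` can be moved by a fibrewise automorphism close to a tuple which depends
only on the fibrewise norms and colours. -/
theorem exists_alignment (hq : q ≠ ∞) {ε : ℝ} {N M : ℕ} (hN : 0 < N)
    (c : ((Fin n → Fin (2 * N + 1)) → Fin (M + 1)) → Fin n →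
          Lp ℝ q (volume : Measure unitInterval))
    (R : ℕ → Lp ℝ q (volume : Measure unitInterval) ≃ₗᵢ[ℝ]
          Lp ℝ q (volume : Measure unitInterval))
    (hR : ∀ k, IsLatticeAutomorphism (R k))
    (hcR : ∀ v : Fin n → Lp ℝ q (volume : Measure unitInterval), 0 < ‖(unit n).eval v‖ →
        ∃ k, ∀ j, ‖R k (v j) - ‖(unit n).eval v‖ • c (color N M v) j‖ < ε * ‖(unit n).eval v‖)
    (h : Fin n → LpLq p q) :
    ∃ T : LpLq p q ≃ₗᵢ[ℝ] LpLq p q, IsLatticeAutomorphism T ∧ ∀ j, ∀ᵐ x,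
      ‖T (h j) x - ‖(unit n).eval fun j => h j x‖ • c (color N M fun j => h j x) j‖ ≤
        ε * ‖(unit n).eval fun j => h j x‖ := by
  classical
  have : Fact (q ≠ ∞) := ⟨hq⟩
  let _ : MeasurableSpace (Lp ℝ q (volume : Measure unitInterval)) := borel _
  have : BorelSpace (Lp ℝ q (volume : Measure unitInterval)) := ⟨rfl⟩
  let H : unitInterval → Fin n → Lp ℝ q (volume : Measure unitInterval) := fun x j => h j x
  have hH : Measurable H := measurable_pi_lambda _ fun j => (Lp.stronglyMeasurable (h j)).measurable
  -- The inequality is weak so that fibres with `e = 0` also have an admissible index; taking the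
  -- least admissible index makes the choice measurable.
  let U := fun (κ : (Fin n → Fin (2 * N + 1)) → Fin (M + 1)) (k : ℕ) =>
    {v : Fin n → Lp ℝ q (volume : Measure unitInterval) |
      ∀ j, ‖R k (v j) - ‖(unit n).eval v‖ • c κ j‖ ≤ ε * ‖(unit n).eval v‖}
  have hU : ∀ κ k, MeasurableSet (U κ k) := fun κ k => by
    have h1 : U κ k = ⋂ j, {v | ‖R k (v j) - ‖(unit n).eval v‖ • c κ j‖ ≤
        ε * ‖(unit n).eval v‖} := by
      ext v; simp [U]
    rw [h1]
    refine (isClosed_iInter fun j => isClosed_le ?_ ?_).measurableSet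
    · exact (((R k).continuous.comp (continuous_apply j)).sub
        ((continuous_eval _).norm.smul continuous_const)).norm
    · exact (continuous_eval _).norm.const_mul ε
  let P : unitInterval → ℕ → Prop := fun x k => H x ∈ U (color N M (H x)) k
  have hP : ∀ x, ∃ k, P x k := fun x => by
    rcases (norm_nonneg ((unit n).eval (H x))).eq_or_lt with h0 | h0
    · refine ⟨0, fun j => ?_⟩
      have h1 := norm_le_norm_eval_unit (H x) j
      rw [← h0] at h1 ⊢
      simpa using h1
    · obtain ⟨k, hk⟩ := hcR (H x) h0
      exact ⟨k, fun j => (hk j).le⟩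
  have hPm : ∀ k, MeasurableSet {x | P x k} := fun k => by
    have h1 : {x | P x k} = ⋃ κ, ((fun x => color N M (H x)) ⁻¹' {κ} ∩ H ⁻¹' U κ k) := by
      ext x
      simp [P]
    rw [h1]
    exact MeasurableSet.iUnion fun κ =>
      (((measurable_color hq hN M).comp hH) (measurableSet_singleton κ)).inter (hH (hU κ k))
  obtain ⟨T, hT, hTf⟩ := exists_automorphism_piecewise (μ := (volume : Measure unitInterval))
    (p := p) (fun x => Nat.find (hP x)) (measurable_find hP hPm) R hR
  refine ⟨T, hT, fun j => ?_⟩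
  filter_upwards [hTf (h j)] with x hx
  rw [hx]
  exact Nat.find_spec (hP x) j

end LatticeTerm

/-! ### Approximate conjugacy of tuples in `L_p(L_q)` -/

namespace LatticeTerm

variable {n : ℕ} {p q : ℝ≥0∞} [Fact (1 ≤ p)] [Fact (1 ≤ q)]

theorem norm_eval_rpow_LpLq (hp : p ≠ ∞) (τ : LatticeTerm n) (h : Fin n → LpLq p q) :
    ‖τ.eval h‖ ^ p.toReal = ∫ x, ‖τ.eval fun j => h j x‖ ^ p.toReal := by
  rw [Lp.norm_rpow_eq_integral hp]
  refine integral_congr_ae ?_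
  filter_upwards [coeFn_eval h τ] with x hx
  rw [hx]

theorem integrable_norm_eval_rpow (hp : p ≠ ∞) (τ : LatticeTerm n) (h : Fin n → LpLq p q) :
    Integrable fun x => ‖τ.eval fun j => h j x‖ ^ p.toReal := by
  refine (Lp.integrable_norm_rpow hp (τ.eval h)).congr ?_
  filter_upwards [coeFn_eval h τ] with x hx
  rw [hx]

-- The norm in each fibre raises coefficients to the power `q`, so the roots `s b ^ (1 / q)` produce
-- a power integral of a linear combination of cell masses. This limit depends only on norms of
-- terms.
open Filter Topology in
theorem tendsto_norm_cellSum_LpLq (hp : p ≠ ∞) (hq : q ≠ ∞) {N : ℕ} (hN : 0 < N)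
    {s : (Fin n → Fin (2 * N + 1)) → ℝ} (hs : ∀ b, 0 ≤ s b) (h : Fin n → LpLq p q) :
    Tendsto (fun m : ℕ => ‖(cellSum N m fun b => s b ^ (q.toReal)⁻¹).eval h‖ ^ p.toReal) atTop
      (𝓝 (∫ x, (∑ b, s b * cellMass N b fun j => h j x) ^ (p.toReal / q.toReal))) := by
  have hq0 : 0 < q.toReal := toReal_exponent_pos hq
  have hp0 : 0 < p.toReal := toReal_exponent_pos hp
  have hs' : ∀ b, 0 ≤ s b ^ (q.toReal)⁻¹ := fun b => Real.rpow_nonneg (hs b) _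
  simp only [norm_eval_rpow_LpLq hp]
  refine tendsto_integral_of_dominated_convergence
    (fun x => (∑ b, s b ^ (q.toReal)⁻¹) ^ p.toReal *
      ‖(unit n).eval fun j => h j x‖ ^ p.toReal)
    (fun m => (integrable_norm_eval_rpow hp _ h).aestronglyMeasurable)
    ((integrable_norm_eval_rpow hp (unit n) h).const_mul _)
    (fun m => Eventually.of_forall fun x => ?_) (Eventually.of_forall fun x => ?_)
  · rw [Real.norm_of_nonneg (Real.rpow_nonneg (norm_nonneg _) _),
      ← Real.mul_rpow (Finset.sum_nonneg fun b _ => hs' b) (norm_nonneg _)]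
    exact Real.rpow_le_rpow (norm_nonneg _) (norm_cellSum_le N m hs' _) hp0.le
  · have h1 := (tendsto_norm_cellSum hq hN hs' fun j => h j x).rpow_const
      (p := p.toReal / q.toReal) (Or.inr (by positivity))
    simp only [Real.rpow_inv_rpow (hs _) hq0.ne'] at h1
    refine h1.congr fun m => ?_
    rw [← Real.rpow_mul (norm_nonneg _), mul_div_cancel₀ _ hq0.ne']

/-- If two tuples in `L_p(L_q)` cannot be distinguished by the norms of terms, then the
fibrewise norms are equally distributed on all colours. -/
theorem eLpNorm_indicator_color_eq (hp : p ≠ ∞) (hq : q ≠ ∞)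
    (hpq : ∀ k : ℕ, p.toReal / q.toReal ≠ (k : ℝ)) {h h' : Fin n → LpLq p q}
    (hh : ∀ τ : LatticeTerm n, ‖τ.eval h‖ = ‖τ.eval h'‖) {N : ℕ} (hN : 0 < N) (M : ℕ)
    (κ : (Fin n → Fin (2 * N + 1)) → Fin (M + 1)) :
    eLpNorm (((fun x => color N M fun j => h j x) ⁻¹' {κ}).indicator
        fun x => ‖(unit n).eval fun j => h j x‖) p volume =
      eLpNorm (((fun x => color N M fun j => h' j x) ⁻¹' {κ}).indicator
        fun x => ‖(unit n).eval fun j => h' j x‖) p volume := by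
  have : Fact (q ≠ ∞) := ⟨hq⟩
  let _ : MeasurableSpace (Lp ℝ q (volume : Measure unitInterval)) := borel _
  have : BorelSpace (Lp ℝ q (volume : Measure unitInterval)) := ⟨rfl⟩
  have hq0 : 0 < q.toReal := toReal_exponent_pos hq
  have hp0 : 0 < p.toReal := toReal_exponent_pos hp
  have hH : ∀ h : Fin n → LpLq p q, Measurable fun x j => h j x := fun h =>
    measurable_pi_lambda _ fun j => (Lp.stronglyMeasurable (h j)).measurable
  let w : (Fin n → LpLq p q) → unitInterval → (Fin n → Fin (2 * N + 1)) → ℝ :=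
    fun h x b => cellMass N b fun j => h j x
  have hw : ∀ h, Measurable (w h) := fun h =>
    measurable_pi_lambda _ fun b => (measurable_cellMass hq hN b).comp (hH h)
  have hw0 : ∀ h x b, 0 ≤ w h x b := fun h x b => cellMass_nonneg N b _
  have hW : ∀ h x, (∑ b, w h x b) ^ (p.toReal / q.toReal) =
      ‖(unit n).eval fun j => h j x‖ ^ p.toReal := fun h x => by
    rw [sum_cellMass hq, ← Real.rpow_mul (norm_nonneg _), mul_div_cancel₀ _ hq0.ne']
  have hWi : ∀ h, Integrable fun x => (∑ b, w h x b) ^ (p.toReal / q.toReal) := fun h => by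
    simp only [hW]; exact integrable_norm_eval_rpow hp _ h
  have hlim : ∀ s : (Fin n → Fin (2 * N + 1)) → ℝ, (∀ b, 0 ≤ s b) →
      ∫ x, (∑ b, s b * w h x b) ^ (p.toReal / q.toReal) =
        ∫ x, (∑ b, s b * w h' x b) ^ (p.toReal / q.toReal) := fun s hs => by
    have h1 := tendsto_norm_cellSum_LpLq hp hq hN hs h
    simp only [hh] at h1
    exact tendsto_nhds_unique h1 (tendsto_norm_cellSum_LpLq hp hq hN hs h')
  have key := setLIntegral_eq_of_integral_rpow_eq (by positivity) hpq (hw h) (hw h') (hw0 h)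
    (hw0 h') (hWi h) (hWi h') hlim
    (measurable_discretize M q.toReal (measurableSet_singleton κ))
  have hnorm : ∀ h : Fin n → LpLq p q,
      eLpNorm (((fun x => color N M fun j => h j x) ⁻¹' {κ}).indicator
        fun x => ‖(unit n).eval fun j => h j x‖) p volume =
      (∫⁻ x in {x | (fun b => w h x b / ∑ b, w h x b) ∈ discretize M q.toReal ⁻¹' {κ}},
        ENNReal.ofReal ((∑ b, w h x b) ^ (p.toReal / q.toReal))) ^ (1 / p.toReal) := by
    intro h
    have hS : MeasurableSet ((fun x => color N M fun j => h j x) ⁻¹' {κ}) :=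
      ((measurable_color hq hN M).comp (hH h)) (measurableSet_singleton κ)
    rw [eLpNorm_indicator_eq_eLpNorm_restrict hS, eLpNorm_eq_lintegral_rpow_enorm_toReal
      (lt_of_lt_of_le zero_lt_one (Fact.out : 1 ≤ p)).ne' hp]
    congr 1
    refine lintegral_congr fun x => ?_
    rw [hW, enorm_norm, ← ofReal_norm, ENNReal.ofReal_rpow_of_nonneg (norm_nonneg _) hp0.le]
  rw [hnorm, hnorm, key]

/-- Tuples in `L_p(L_q)` which cannot be distinguished by the norms of terms are nearly exchanged
by a lattice automorphism. -/
theorem exists_automorphism_of_norm_eval_eq (hp : p ≠ ∞) (hq : q ≠ ∞)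
    (hpq : ∀ k : ℕ, p.toReal / q.toReal ≠ (k : ℝ)) {h h' : Fin n → LpLq p q}
    (hh : ∀ τ : LatticeTerm n, ‖τ.eval h‖ = ‖τ.eval h'‖) {ε : ℝ} (hε : 0 < ε) :
    ∃ φ : LpLq p q ≃ₗᵢ[ℝ] LpLq p q, IsLatticeAutomorphism φ ∧ ∀ j, ‖φ (h j) - h' j‖ < ε := by
  classical
  have hp1 : 1 ≤ p := Fact.out
  have : Fact (q ≠ ∞) := ⟨hq⟩
  let _ : MeasurableSpace (Lp ℝ q (volume : Measure unitInterval)) := borel _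
  have : BorelSpace (Lp ℝ q (volume : Measure unitInterval)) := ⟨rfl⟩
  set a := ‖(unit n).eval h‖ with ha
  have ha0 : 0 ≤ a := norm_nonneg _
  -- The two alignments and the transport contribute at most `ε / 4` each; adding `1` to `a`, and
  -- later to `K`, avoids division by zero.
  obtain ⟨N, M, hN, c, R, hc, hR, hcR⟩ := exists_reference n q hq
    (show 0 < ε / (4 * (a + 1)) by positivity)
  set ε₁ := ε / (4 * (a + 1)) with hε₁
  let K : ℝ := Fintype.card ((Fin n → Fin (2 * N + 1)) → Fin (M + 1))
  have hK : 0 ≤ K := Nat.cast_nonneg _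
  let u : (Fin n → LpLq p q) → unitInterval → ℝ := fun h x => ‖(unit n).eval fun j => h j x‖
  let d : (Fin n → LpLq p q) → unitInterval → (Fin n → Fin (2 * N + 1)) → Fin (M + 1) :=
    fun h x => color N M fun j => h j x
  have hH : ∀ h : Fin n → LpLq p q, Measurable fun x j => h j x := fun h =>
    measurable_pi_lambda _ fun j => (Lp.stronglyMeasurable (h j)).measurable
  have hu : ∀ h, Measurable (u h) := fun h =>
    (continuous_eval (V := Lp ℝ q (volume : Measure unitInterval)) (unit n)).norm.measurable.comp
      (hH h)
  have hd : ∀ h, Measurable (d h) := fun h => (measurable_color hq hN M).comp (hH h)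
  have hur : ∀ h, MemLp (u h) p volume := fun h => by
    refine (memLp_congr_ae ?_).1 (Lp.memLp ((unit n).eval h)).norm
    filter_upwards [coeFn_eval h (unit n)] with x hx
    rw [hx]
  obtain ⟨σ, w, hT, happ⟩ := exists_isTransport_approx p hp (hu h) (hu h')
    (fun x => norm_nonneg _) (fun x => norm_nonneg _) (hur h) (hur h') (hd h) (hd h')
    (show 0 < ε / (4 * (K + 1)) by positivity)
  obtain ⟨S, hS, hSf⟩ := hT.exists_automorphism (Lp ℝ q (volume : Measure unitInterval))
  obtain ⟨T, hTa, hTh⟩ := exists_alignment hq hN c R hR hcR h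
  obtain ⟨T', hTa', hTh'⟩ := exists_alignment hq hN c R hR hcR h'
  -- The aligned tuple is a finite sum of scalar functions times fixed vectors of `L_q`, so the base
  -- transport acts on its scalar coefficients alone.
  let g : (Fin n → LpLq p q) → Fin n → unitInterval → Lp ℝ q (volume : Measure unitInterval) :=
    fun h j x => ∑ κ, (d h ⁻¹' {κ}).indicator (u h) x • c κ j
  have hg : ∀ h j x, g h j x = u h x • c (d h x) j := fun h j x => by
    simp only [g]
    rw [Finset.sum_eq_single (d h x)]
    · rw [Set.indicator_of_mem (by rfl)]
    · intro κ _ hκ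
      rw [Set.indicator_of_notMem (show x ∉ d h ⁻¹' {κ} from fun hx => hκ (Eq.symm hx)), zero_smul]
    · simp
  have hgm : ∀ h j, MemLp (g h j) p volume := fun h j => by
    refine MemLp.of_le (hur h) ?_ (Filter.Eventually.of_forall fun x => ?_)
    · exact (Finset.stronglyMeasurable_fun_sum _ fun κ _ => StronglyMeasurable.smul_const
        (((hu h).indicator (hd h (measurableSet_singleton κ))).stronglyMeasurable)
        (c κ j)).aestronglyMeasurable
    · rw [hg, norm_smul]
      exact mul_le_of_le_one_right (norm_nonneg _) (hc _ _)
  have halign : ∀ (h : Fin n → LpLq p q) (T : LpLq p q ≃ₗᵢ[ℝ] LpLq p q) (j : Fin n),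
      (∀ᵐ x, ‖T (h j) x - u h x • c (d h x) j‖ ≤ ε₁ * u h x) →
      ‖T (h j) - (hgm h j).toLp‖ ≤ ε₁ * ‖(unit n).eval h‖ := by
    intro h T j hTh
    refine Lp.norm_le_mul_norm_of_ae_le_mul ?_
    filter_upwards [hTh, Lp.coeFn_sub (T (h j)) (hgm h j).toLp, (hgm h j).coeFn_toLp,
      coeFn_eval h (unit n)] with x h1 h2 h3 h4
    rw [h2, Pi.sub_apply, h3, h4, hg]
    exact h1
  have htrans : ∀ j, ‖S (hgm h j).toLp - (hgm h' j).toLp‖ ≤ K * (ε / (4 * (K + 1))) := by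
    intro j
    rw [Lp.norm_def]
    refine ENNReal.toReal_le_of_le_ofReal (by positivity) ?_
    let f := fun κ x => w x * (d h ⁻¹' {κ}).indicator (u h) (σ x) -
      (d h' ⁻¹' {κ}).indicator (u h') x
    have hfm : ∀ κ, MemLp (f κ) p volume := fun κ =>
      (hT.eLpNorm_comp ((hur h).indicator (hd h (measurableSet_singleton κ)))).1.sub
        ((hur h').indicator (hd h' (measurableSet_singleton κ)))
    have h1 : S (hgm h j).toLp - (hgm h' j).toLp =ᵐ[volume] ∑ κ, fun x => f κ x • c κ j := by
      filter_upwards [Lp.coeFn_sub (S (hgm h j).toLp) (hgm h' j).toLp, hSf (hgm h j).toLp,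
        hT.quasiMeasurePreserving.ae (hgm h j).coeFn_toLp, (hgm h' j).coeFn_toLp]
        with x h1 h2 h3 h4
      rw [h1, Pi.sub_apply, h2, h3, h4, Finset.sum_apply]
      simp only [g, f, Finset.smul_sum, ← Finset.sum_sub_distrib, smul_smul, sub_smul]
    rw [eLpNorm_congr_ae h1]
    refine (eLpNorm_sum_le (fun κ _ => (hfm κ).1.smul_const (c κ j)) hp1).trans ?_
    calc ∑ κ, eLpNorm (fun x => f κ x • c κ j) p volume
        ≤ ∑ _κ : (Fin n → Fin (2 * N + 1)) → Fin (M + 1),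
            ENNReal.ofReal (ε / (4 * (K + 1))) := by
          refine Finset.sum_le_sum fun κ _ => ?_
          have h2 : eLpNorm (fun x => f κ x • c κ j) p volume ≤ eLpNorm (f κ) p volume :=
            eLpNorm_mono fun x => by
              rw [norm_smul]; exact mul_le_of_le_one_right (norm_nonneg _) (hc _ _)
          refine h2.trans ((happ κ).trans (le_of_eq ?_))
          -- Equality of the norms on each colour leaves only the arbitrarily small error of the
          -- transport.
          rw [eLpNorm_indicator_color_eq hp hq hpq hh hN M κ, sub_self, abs_zero, zero_add]
      _ = _ := by
          rw [Finset.sum_const, nsmul_eq_mul, ENNReal.ofReal_mul hK, ENNReal.ofReal_natCast]; rfl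
  refine ⟨(T.trans S).trans T'.symm, (hTa.trans hS).trans hTa'.symm, fun j => ?_⟩
  have e1 := halign h T j (hTh j)
  have e2 := halign h' T' j (hTh' j)
  have e3 := htrans j
  rw [← hh, ← ha] at e2
  rw [← ha] at e1
  have e4 : ‖((T.trans S).trans T'.symm) (h j) - h' j‖ = ‖S (T (h j)) - T' (h' j)‖ := by
    rw [← T'.norm_map, map_sub]
    simp
  have e5 : S (T (h j)) - T' (h' j) = S (T (h j) - (hgm h j).toLp) +
      (S (hgm h j).toLp - (hgm h' j).toLp) - (T' (h' j) - (hgm h' j).toLp) := by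
    rw [map_sub]; abel
  rw [e4, e5]
  have e6 : ε₁ * a ≤ ε / 4 := by
    rw [hε₁, div_mul_eq_mul_div, div_le_div_iff₀ (by positivity) (by positivity)]
    nlinarith
  have e7 : K * (ε / (4 * (K + 1))) ≤ ε / 4 := by
    rw [mul_div_assoc', div_le_div_iff₀ (by positivity) (by positivity)]
    nlinarith
  have e8 := norm_sub_le (S (T (h j) - (hgm h j).toLp) +
    (S (hgm h j).toLp - (hgm h' j).toLp)) (T' (h' j) - (hgm h' j).toLp)
  have e9 := norm_add_le (S (T (h j) - (hgm h j).toLp)) (S (hgm h j).toLp - (hgm h' j).toLp)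
  rw [S.norm_map] at e9
  linarith

end LatticeTerm

theorem theoremt (p q : ℝ≥0∞) [Fact (1 ≤ p)] [Fact (1 ≤ q)] (hp : p ≠ ∞) (hq : q ≠ ∞)
    (hpq : ∀ k : ℕ, p.toReal / q.toReal ≠ (k : ℝ)) :
    IsApproxUltrahomogeneousOver (LpLq p q) (finitelyGeneratedSublattices.{u} (LpLq p q)) := by
  intro E _ n e _ f₁ f₂ hf₁ hf₂ ε hε
  refine LatticeTerm.exists_automorphism_of_norm_eval_eq hp hq hpq (fun τ => ?_) hε
  -- Both norms equal that of the term evaluated in `E`.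
  rw [← LatticeTerm.map_eval hf₁, ← LatticeTerm.map_eval hf₂, f₁.norm_map, f₂.norm_map]
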